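/- Let $k$ be a field of characteristic zero and $k(\alpha)/k$ a quadratic extension with $\alpha\notin k$, $\alpha^2\in k$; let $\sigma$ be the non-trivial element of $\mathrm{Gal}(k(\alpha)/k)$. For a commutative $k$-algebra $R$ put $R(\alpha)=R\otimes_k k(\alpha)$, with $\sigma$ acting through the second factor, and ${}^*A={}^tA^\sigma$ for a matrix $A$ over $R(\alpha)$. Let $W=k^7$ with standard basis $e_1,\dots,e_7$, $e_{ij}=e_i\wedge e_j$, $e_{ijl}=e_i\wedge e_j\wedge e_l$, and $$\bar w=e_{234}+e_{567}+e_1\wedge(e_{25}+e_{36}+e_{47})\in\wedge^3W .$$ Let $G_1\subset \mathrm{GL}(7)$ be the algebraic group of all $g$ such that $g\bar w=c(g)\bar w$ with $c(g)\in\mathrm{GL}(1)$, and $G=G_1\times\mathrm{GL}(2)$. It acts on $V=W\otimes k^2$, the space of linear forms $M(v)$ in $v=(v_1,v_2)$ with coefficients in $W$, by $(g_1,g_2)M(v)=g_1M(vg_2)$. Let $\tilde T=\mathrm{Ker}(G\to\mathrm{GL}(V))$ and $w=v_1e_2+v_2e_5\in V$. For $A\in\mathrm{GL}(2)$ let $d(A)=(d_1(A),d_2(A))$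 with $$d_1(A)=\mathrm{diag}\bigl(1,(\det A)^{-1},A,\det A,{}^tA^{-1}\bigr)\ \text{(block diagonal)},\qquad d_2(A)=\mathrm{diag}\bigl(\det A,(\det A)^{-1}\bigr).$$ Let $g_\alpha=(g_{\alpha,1},g_{\alpha,2})\in G_{k(\alpha)}$, where $g_{\alpha,2}=\begin{pmatrix}1&1\\ \alpha&-\alpha\end{pmatrix}$ and $$g_{\alpha,1}=\alpha\,\mathrm{diag}(1,\alpha,1,\alpha^{-1},\alpha^{-1},1,\alpha)\,h_0,\qquad h_0=\begin{pmatrix}0&-1&0&0&1&0&0\\ \frac12&\frac12&0&0&\frac12&0&0\\ 0&0&\frac12&-\frac12&0&-\frac12&-\frac12\\ 0&0&\frac12&\frac12&0&\frac12&-\frac12\\ -\frac12&\frac12&0&0&\frac12&0&0\\ 0&0&-\frac12&-\frac12&0&\frac12&-\frac12\\ 0&0&\frac12&-\frac12&0&\frac12&\frac12\end{pmatrix}.$$ Let $\Lambda=\begin{pmatrix}1&0\\0&-1\end{pmatrix}$ and let $U_\alpha(1,1)$ be the algebraic group over $k$ with $U_\alpha(1,1)_R=\{A\in\mathrm{GL}(2)_{R(\alpha)}\mid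 A\Lambda\,{}^*A=\Lambda\}$ for every $k$-algebra $R$. Proposition. The point $w_\alpha=g_\alpha w$ lies in $V_k$. Let $G_{w_\alpha}\subset G$ be its stabilizer, an algebraic group over $k$, and $G_{w_\alpha}^0$ the identity component of $G_{w_\alpha}$. Then, as algebraic groups over $k$, $$G_{w_\alpha}^0=\{g_\alpha d(A)g_\alpha^{-1}\mid A\in U_\alpha(1,1)\}\times\tilde T\cong U_\alpha(1,1)\times\tilde T .$$ That is, for every commutative $k$-algebra $R$, the set $G_{w_\alpha}^0(R)$ is a subgroup of $G(R)$ whose image in $G(R(\alpha))$ is the set of all $g_\alpha d(A)g_\alpha^{-1}t$ with $A\in U_\alpha(1,1)_R$, $t\in\tilde T_R$, and $(A,t)\mapsto g_\alpha d(A)g_\alpha^{-1}t$ defines a group isomorphism $U_\alpha(1,1)_R\times\tilde T_R\to G_{w_\alpha}^0(R)$, functorial in $R$. -/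

import Mathlib

open scoped TensorProduct

universe u v w

namespace PrehomG2

/-! ### The group `G = G₁ × GL(2)` and its representation on `V = W ⊗ k²` -/

section Group

variable (R : Type v) [CommRing R]

/-- The standard basis vectors of `W = R⁷`, with indices shifted by one: `e 0, …, e 6`. -/
def e (i : Fin 7) : Fin 7 → R := Pi.single i 1

/-- The decomposable trivector `e_i ∧ e_j ∧ e_l` (zero-based indices). -/
noncomputable def tri (i j l : Fin 7) : ⋀[R]^3 (Fin 7 → R) :=
  exteriorPower.ιMulti R 3 ![e R i, e R j, e R l]

/-- `w̄ = e₂₃₄ + e₅₆₇ + e₁ ∧ (e₂₅ + e₃₆ + e₄₇)`, written with zero-based indices. -/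
noncomputable def wBar : ⋀[R]^3 (Fin 7 → R) :=
  tri R 1 2 3 + tri R 4 5 6 + (tri R 0 1 4 + tri R 0 2 5 + tri R 0 3 6)

/-- The `R`-points of `G₁`: those `g ∈ GL(7)` with `g w̄ = c w̄` for some unit `c`. -/
noncomputable def G1 : Subgroup (GL (Fin 7) R) where
  carrier := {g | ∃ c : Rˣ,
    exteriorPower.map 3 (Matrix.mulVecLin (g : Matrix (Fin 7) (Fin 7) R)) (wBar R) =
      (c : R) • wBar R}
  one_mem' := ⟨1, by simp⟩
  mul_mem' := by
    rintro a b ⟨c, hc⟩ ⟨d, hd⟩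
    refine ⟨c * d, ?_⟩
    rw [Units.val_mul, Matrix.mulVecLin_mul, exteriorPower.map_comp, LinearMap.comp_apply,
      hd, map_smul, hc, smul_smul, Units.val_mul, mul_comm]
  inv_mem' := by
    rintro a ⟨c, hc⟩
    refine ⟨c⁻¹, ?_⟩
    have h : exteriorPower.map 3 (Matrix.mulVecLin ((a⁻¹ : GL (Fin 7) R) :
        Matrix (Fin 7) (Fin 7) R)) (exteriorPower.map 3
          (Matrix.mulVecLin (a : Matrix (Fin 7) (Fin 7) R)) (wBar R)) = wBar R := by
      rw [← LinearMap.comp_apply, ← exteriorPower.map_comp, ← Matrix.mulVecLin_mul,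
        ← Units.val_mul, inv_mul_cancel]
      simp
    rw [hc, map_smul] at h
    rw [← h, smul_smul, Units.inv_mul, one_smul, h]

/-- The `R`-points of the ambient group `GL(7) × GL(2)`. -/
abbrev Amb : Type v := GL (Fin 7) R × GL (Fin 2) R

/-- The `R`-points of `G = G₁ × GL(2)`. -/
noncomputable def G : Subgroup (Amb R) := (G1 R).prod ⊤

/-- The `R`-points of `V = W ⊗ k²`: the linear form `M(v) = v₁ x₁ + v₂ x₂` with `x₁, x₂ ∈ W` is
the `7 × 2` matrix with columns `x₁, x₂`. -/
abbrev V : Type v := Matrix (Fin 7) (Fin 2) R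

variable {R} in
/-- The `W`-valued linear form in `v = (v₁, v₂)` attached to an element of `V`. -/
def linForm (x : V R) (v : Fin 2 → R) : Fin 7 → R := v 0 • x.col 0 + v 1 • x.col 1

/-- The action of `GL(7) × GL(2)` on `V`; see `linForm_rep` for its description
`(g M)(v) = g₁ M(v g₂)` in terms of linear forms. -/
def rep : Amb R →* Module.End R (V R) where
  toFun g :=
    { toFun := fun x => (g.1 : Matrix (Fin 7) (Fin 7) R) * x *
        (g.2 : Matrix (Fin 2) (Fin 2) R).transpose
      map_add' := fun x y => by rw [Matrix.mul_add, Matrix.add_mul]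
      map_smul' := fun c x => by simp }
  map_one' := by ext x : 1; simp
  map_mul' g h := by
    refine LinearMap.ext fun x => ?_
    simp [Matrix.transpose_mul, Matrix.mul_assoc]

theorem linForm_rep (g : Amb R) (x : V R) (v : Fin 2 → R) :
    linForm (rep R g x) v =
      Matrix.mulVec (g.1 : Matrix (Fin 7) (Fin 7) R)
        (linForm x (Matrix.vecMul v (g.2 : Matrix (Fin 2) (Fin 2) R))) := by
  have key : ∀ (y : V R) (u : Fin 2 → R), linForm y u = Matrix.mulVec y u := by
    intro y u
    ext i
    simp [linForm, Matrix.mulVec, dotProduct, Fin.sum_univ_two, mul_comm]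
  rw [key, key, Matrix.mulVec_mulVec]
  change Matrix.mulVec ((g.1 : Matrix (Fin 7) (Fin 7) R) * x *
    (g.2 : Matrix (Fin 2) (Fin 2) R).transpose) v = _
  rw [← Matrix.mulVec_mulVec, Matrix.mulVec_transpose]

/-- The `R`-points of `T̃ = Ker(G → GL(V))`. -/
noncomputable def tildeT : Subgroup (Amb R) := G R ⊓ (rep R).ker

/-- The point `w = v₁ e₂ + v₂ e₅` of `V` (the indices of the basis being one-based here). -/
def wPt : V R := Matrix.of fun i j => ![e R 1, e R 4] j i

end Group

/-! ### Functoriality in the ring -/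

section BaseChange

variable {R : Type v} [CommRing R] {S : Type w} [CommRing S]

/-- The map `GL(7, R) × GL(2, R) → GL(7, S) × GL(2, S)` induced by a ring homomorphism. -/
def Amb.map (f : R →+* S) : Amb R →* Amb S :=
  (Matrix.GeneralLinearGroup.map f).prodMap (Matrix.GeneralLinearGroup.map f)

theorem G1_map (f : R →+* S) {g : GL (Fin 7) R} (hg : g ∈ G1 R) :
    Matrix.GeneralLinearGroup.map f g ∈ G1 S := by
  obtain ⟨c, hc⟩ := hg
  refine ⟨Units.map f c, ?_⟩
  let _ : Algebra R S := f.toAlgebra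
  let φ : (Fin 7 → R) →ₗ[R] (Fin 7 → S) :=
    { toFun := fun x i => f (x i)
      map_add' := fun x y => by ext i; simp
      map_smul' := fun r x => by ext i; simp [Algebra.smul_def, RingHom.algebraMap_toAlgebra] }
  let A : (Fin 7 → R) [⋀^Fin 3]→ₗ[R] (⋀[S]^3 (Fin 7 → S)) :=
    { toFun := fun m => exteriorPower.ιMulti S 3 (fun i => φ (m i))
      map_update_add' := by
        intro _ m i x y
        have : ∀ z, (fun j => φ (Function.update m i z j)) =
            Function.update (fun j => φ (m j)) i (φ z) := by
          intro z; ext1 j; by_cases h : j = i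
          · subst h; simp
          · simp [h]
        have h3 : ‹DecidableEq (Fin 3)› = instDecidableEqFin 3 := Subsingleton.elim _ _
        subst h3
        simp only [this, map_add, AlternatingMap.map_update_add]
      map_update_smul' := by
        intro _ m i r x
        have : ∀ z, (fun j => φ (Function.update m i z j)) =
            Function.update (fun j => φ (m j)) i (φ z) := by
          intro z; ext1 j; by_cases h : j = i
          · subst h; simp
          · simp [h]
        have h3 : ‹DecidableEq (Fin 3)› = instDecidableEqFin 3 := Subsingleton.elim _ _
        subst h3
        simp only [this]
        rw [map_smul, ← algebraMap_smul S r (φ x), AlternatingMap.map_update_smul,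
          algebraMap_smul]
      map_eq_zero_of_eq' := by
        intro m i j h hij
        exact AlternatingMap.map_eq_zero_of_eq _ _ (by simp [h]) hij }
  let L := exteriorPower.alternatingMapLinearEquiv A
  have hL : ∀ m, L (exteriorPower.ιMulti R 3 m) = exteriorPower.ιMulti S 3 (fun i => φ (m i)) :=
    fun m => exteriorPower.alternatingMapLinearEquiv_apply_ιMulti A m
  have hφe : ∀ i, φ (e R i) = e S i := by
    intro i; ext j
    simp only [φ, e, LinearMap.coe_mk, AddHom.coe_mk]
    by_cases h : j = i
    · subst h; simp
    · simp [h]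
  have hvec : ∀ i j l : Fin 7, (fun a : Fin 3 => φ ((![e R i, e R j, e R l] : Fin 3 → _) a)) =
      ![e S i, e S j, e S l] := by
    intro i j l; ext1 a; fin_cases a <;> simp [hφe]
  have hw : L (wBar R) = wBar S := by
    simp only [wBar, tri, map_add, hL, hvec]
  have hmv : ∀ x, φ (Matrix.mulVecLin (g : Matrix (Fin 7) (Fin 7) R) x) =
      Matrix.mulVecLin ((Matrix.GeneralLinearGroup.map f g : GL (Fin 7) S) :
        Matrix (Fin 7) (Fin 7) S) (φ x) := by
    intro x; ext i
    simp [φ, Matrix.mulVec, dotProduct, map_sum]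
  have hnat : L (exteriorPower.map 3 (Matrix.mulVecLin (g : Matrix (Fin 7) (Fin 7) R)) (wBar R)) =
      exteriorPower.map 3 (Matrix.mulVecLin ((Matrix.GeneralLinearGroup.map f g : GL (Fin 7) S) :
        Matrix (Fin 7) (Fin 7) S)) (wBar S) := by
    rw [← hw]
    have : ∀ m, L (exteriorPower.map 3 (Matrix.mulVecLin (g : Matrix (Fin 7) (Fin 7) R))
        (exteriorPower.ιMulti R 3 m)) =
      exteriorPower.map 3 (Matrix.mulVecLin ((Matrix.GeneralLinearGroup.map f g : GL (Fin 7) S) :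
        Matrix (Fin 7) (Fin 7) S)) (L (exteriorPower.ιMulti R 3 m)) := by
      intro m
      rw [exteriorPower.map_apply_ιMulti, hL, hL, exteriorPower.map_apply_ιMulti]
      congr 1
      ext1 a
      exact hmv (m a)
    simp only [wBar, tri, map_add, this]
  rw [← hnat, hc, map_smul, hw, ← algebraMap_smul S (c : R) (wBar S)]
  rfl

theorem tildeT_map (f : R →+* S) {g : Amb R} (hg : g ∈ tildeT R) : Amb.map f g ∈ tildeT S := by
  refine ⟨⟨G1_map f hg.1.1, trivial⟩, ?_⟩
  have h : ∀ x : V R, (g.1 : Matrix (Fin 7) (Fin 7) R) * x *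
      (g.2 : Matrix (Fin 2) (Fin 2) R).transpose = x := fun x =>
    LinearMap.congr_fun (MonoidHom.mem_ker.mp hg.2) x
  refine MonoidHom.mem_ker.mpr (Matrix.ext_linearMap _ fun i j => LinearMap.ext_ring ?_)
  ext i' j'
  have h1 := congrArg f (congrFun (congrFun (h (Matrix.single i j 1)) i') j')
  simp only [Matrix.mul_apply, map_sum, map_mul, Matrix.transpose_apply] at h1
  have h2 : ∀ a b, f ((Matrix.single i j (1 : R)) a b) = (Matrix.single i j (1 : S)) a b := by
    intro a b
    by_cases hh : i = a ∧ j = b <;> simp [Matrix.single, hh]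
  simp only [h2] at h1
  simpa [rep, Amb.map, Matrix.mul_apply] using h1

/-- The homomorphism `T̃(R) → T̃(S)` induced by a ring homomorphism. -/
noncomputable def tildeTMap (f : R →+* S) : tildeT R →* tildeT S :=
  ((Amb.map f).comp (tildeT R).subtype).codRestrict (tildeT S) fun g => tildeT_map f g.2

end BaseChange

/-! ### The homomorphism `d` and the unitary group -/

section Unitary

variable {S : Type v} [CommRing S]

/-- The block diagonal matrix `d₁(A) = diag(1, (det A)⁻¹, A, det A, ᵗA⁻¹)`. -/
def d1Mat (A : GL (Fin 2) S) : Matrix (Fin 7) (Fin 7) S :=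
  let δ : Sˣ := Matrix.GeneralLinearGroup.det A
  let B : GL (Fin 2) S := A⁻¹
  !![1, 0, 0, 0, 0, 0, 0;
     0, ((δ⁻¹ : Sˣ) : S), 0, 0, 0, 0, 0;
     0, 0, A 0 0, A 0 1, 0, 0, 0;
     0, 0, A 1 0, A 1 1, 0, 0, 0;
     0, 0, 0, 0, (δ : S), 0, 0;
     0, 0, 0, 0, 0, B 0 0, B 1 0;
     0, 0, 0, 0, 0, B 0 1, B 1 1]

/-- The diagonal matrix `d₂(A) = diag(det A, (det A)⁻¹)`. -/
def d2Mat (A : GL (Fin 2) S) : Matrix (Fin 2) (Fin 2) S :=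
  let δ : Sˣ := Matrix.GeneralLinearGroup.det A
  !![(δ : S), 0; 0, ((δ⁻¹ : Sˣ) : S)]

theorem d1Mat_one : d1Mat (1 : GL (Fin 2) S) = 1 := by
  ext i j
  fin_cases i <;> fin_cases j <;> simp [d1Mat]

theorem d1Mat_mul_aux (x y a b c d p q r t x' y' a' b' c' d' p' q' r' t' : S) :
    (!![1, 0, 0, 0, 0, 0, 0; 0, x, 0, 0, 0, 0, 0; 0, 0, a, b, 0, 0, 0; 0, 0, c, d, 0, 0, 0;
        0, 0, 0, 0, y, 0, 0; 0, 0, 0, 0, 0, p, q; 0, 0, 0, 0, 0, r, t] :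
        Matrix (Fin 7) (Fin 7) S) *
      !![1, 0, 0, 0, 0, 0, 0; 0, x', 0, 0, 0, 0, 0; 0, 0, a', b', 0, 0, 0;
        0, 0, c', d', 0, 0, 0; 0, 0, 0, 0, y', 0, 0; 0, 0, 0, 0, 0, p', q';
        0, 0, 0, 0, 0, r', t'] =
      !![1, 0, 0, 0, 0, 0, 0; 0, x * x', 0, 0, 0, 0, 0;
        0, 0, a * a' + b * c', a * b' + b * d', 0, 0, 0;
        0, 0, c * a' + d * c', c * b' + d * d', 0, 0, 0;
        0, 0, 0, 0, y * y', 0, 0; 0, 0, 0, 0, 0, p * p' + q * r', p * q' + q * t';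
        0, 0, 0, 0, 0, r * p' + t * r', r * q' + t * t'] := by
  ext i j
  fin_cases i <;> fin_cases j <;> simp [Matrix.mul_apply, Fin.sum_univ_succ]

theorem d1Mat_mul (A B : GL (Fin 2) S) : d1Mat (A * B) = d1Mat A * d1Mat B := by
  simp only [d1Mat]
  rw [d1Mat_mul_aux, mul_inv_rev, map_mul, mul_inv]
  simp only [Units.val_mul, Matrix.mul_apply, Fin.sum_univ_two]
  simp only [mul_comm]

theorem d2Mat_one : d2Mat (1 : GL (Fin 2) S) = 1 := by
  ext i j
  fin_cases i <;> fin_cases j <;> simp [d2Mat]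

theorem d2Mat_mul (A B : GL (Fin 2) S) : d2Mat (A * B) = d2Mat A * d2Mat B := by
  ext i j
  fin_cases i <;> fin_cases j <;> simp [d2Mat, mul_comm]

/-- `d(A) = (d₁(A), d₂(A))`. -/
def d : GL (Fin 2) S →* Amb S :=
  (MonoidHom.toHomUnits ⟨⟨d1Mat, d1Mat_one⟩, d1Mat_mul⟩).prod
    (MonoidHom.toHomUnits ⟨⟨d2Mat, d2Mat_one⟩, d2Mat_mul⟩)

variable (S) in
/-- `Λ = diag(1, -1)`. -/
def Lam : Matrix (Fin 2) (Fin 2) S := !![1, 0; 0, -1]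

/-- For a ring endomorphism `s`, the group of `A ∈ GL(2, S)` with `A Λ ᵗ(A^s) = Λ`. -/
def unitaryOf (s : S →+* S) : Subgroup (GL (Fin 2) S) where
  carrier := {A | (A : Matrix (Fin 2) (Fin 2) S) * Lam S *
    ((A : Matrix (Fin 2) (Fin 2) S).map s).transpose = Lam S}
  one_mem' := by simp
  mul_mem' := by
    intro A B hA hB
    simp only [Set.mem_ofPred_eq] at *
    rw [Units.val_mul, Matrix.map_mul, Matrix.transpose_mul]
    calc _ = (A : Matrix (Fin 2) (Fin 2) S) * ((B : Matrix (Fin 2) (Fin 2) S) * Lam S *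
          ((B : Matrix (Fin 2) (Fin 2) S).map s).transpose) *
          ((A : Matrix (Fin 2) (Fin 2) S).map s).transpose := by simp only [Matrix.mul_assoc]
      _ = _ := by rw [hB, hA]
  inv_mem' := by
    intro A hA
    simp only [Set.mem_ofPred_eq] at *
    have h1 : ((A⁻¹ : GL (Fin 2) S) : Matrix (Fin 2) (Fin 2) S) *
        (A : Matrix (Fin 2) (Fin 2) S) = 1 := A.inv_mul
    have h2 : ((A : Matrix (Fin 2) (Fin 2) S).map s).transpose *
        (((A⁻¹ : GL (Fin 2) S) : Matrix (Fin 2) (Fin 2) S).map s).transpose = 1 := by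
      rw [← Matrix.transpose_mul, ← Matrix.map_mul, h1]
      simp
    conv_lhs => rw [← hA]
    calc _ = (((A⁻¹ : GL (Fin 2) S) : Matrix (Fin 2) (Fin 2) S) *
          (A : Matrix (Fin 2) (Fin 2) S)) * Lam S *
          (((A : Matrix (Fin 2) (Fin 2) S).map s).transpose *
        (((A⁻¹ : GL (Fin 2) S) : Matrix (Fin 2) (Fin 2) S).map s).transpose) := by
          simp only [Matrix.mul_assoc]
      _ = _ := by rw [h1, h2]; simp

end Unitary

section Forms

variable {k : Type u} [Field k] {K : Type w} [Field K] [Algebra k K]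

/-- The action of `σ` on `R(α) = R ⊗ k(α)`, `(r ⊗ x)^σ = r ⊗ x^σ`. -/
noncomputable def conj (σ : K ≃ₐ[k] K) (R : Type v) [CommRing R] [Algebra k R] :
    (R ⊗[k] K) →+* (R ⊗[k] K) :=
  (Algebra.TensorProduct.map (AlgHom.id k R) (σ : K →ₐ[k] K)).toRingHom

/-- The `R`-points of the algebraic group `U_α(1,1)` over `k`, where `K = k(α)` and `σ` is the
non-trivial element of its Galois group: `{A ∈ GL(2, R ⊗ K) | A Λ *A = Λ}`, `*A = ᵗ(A^σ)`. -/
noncomputable def U11 (σ : K ≃ₐ[k] K) (R : Type v) [CommRing R] [Algebra k R] :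
    Subgroup (GL (Fin 2) (R ⊗[k] K)) :=
  unitaryOf (conj σ R)

variable (K) in
/-- The homomorphism `R ⊗ K → R' ⊗ K` induced by `f : R → R'`. -/
noncomputable def extMap {R R' : Type v} [CommRing R] [Algebra k R] [CommRing R'] [Algebra k R']
    (f : R →ₐ[k] R') : (R ⊗[k] K) →+* (R' ⊗[k] K) :=
  (Algebra.TensorProduct.map f (AlgHom.id k K)).toRingHom

theorem U11_map (σ : K ≃ₐ[k] K) {R R' : Type v} [CommRing R] [Algebra k R] [CommRing R']
    [Algebra k R'] (f : R →ₐ[k] R') {A : GL (Fin 2) (R ⊗[k] K)} (hA : A ∈ U11 σ R) :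
    Matrix.GeneralLinearGroup.map (extMap K f) A ∈ U11 σ R' := by
  have hc : ∀ z, conj σ R' (extMap K f z) = extMap K f (conj σ R z) := by
    intro z
    induction z with
    | zero => simp
    | tmul r x => simp [conj, extMap]
    | add x y hx hy => simp [hx, hy]
  have h := congrArg (fun M => M.map (extMap K f)) (show _ = _ from hA)
  simp only [Matrix.map_mul] at h
  have hL : (Lam (R ⊗[k] K)).map (extMap K f) = Lam (R' ⊗[k] K) := by
    ext i j
    fin_cases i <;> fin_cases j <;> simp [Lam]
  rw [hL] at h
  have h2 : ((A : Matrix (Fin 2) (Fin 2) (R ⊗[k] K)).map (conj σ R)).map (extMap K f) =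
      ((A : Matrix (Fin 2) (Fin 2) (R ⊗[k] K)).map (extMap K f)).map (conj σ R') := by
    ext i j
    simp [hc]
  rw [Matrix.transpose_map, h2] at h
  exact h

/-- The homomorphism `U_α(1,1)(R) → U_α(1,1)(R')` induced by `f : R → R'`. -/
noncomputable def U11Map (σ : K ≃ₐ[k] K) {R R' : Type v} [CommRing R] [Algebra k R] [CommRing R']
    [Algebra k R'] (f : R →ₐ[k] R') : U11 σ R →* U11 σ R' :=
  ((Matrix.GeneralLinearGroup.map (extMap K f)).comp (U11 σ R).subtype).codRestrict (U11 σ R')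
    fun A => U11_map σ f A.2

variable (k K) in
/-- The base change homomorphism `GL(7, R) × GL(2, R) → GL(7, R ⊗ K) × GL(2, R ⊗ K)`. -/
noncomputable def toExt (R : Type v) [CommRing R] [Algebra k R] : Amb R →* Amb (R ⊗[k] K) :=
  Amb.map (Algebra.TensorProduct.includeLeft : R →ₐ[k] (R ⊗[k] K)).toRingHom

variable (k) in
/-- The homomorphism `GL(7, K) × GL(2, K) → GL(7, R ⊗ K) × GL(2, R ⊗ K)`. -/
noncomputable def ofField (R : Type v) [CommRing R] [Algebra k R] : Amb K →* Amb (R ⊗[k] K) :=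
  Amb.map (Algebra.TensorProduct.includeRight : K →ₐ[k] (R ⊗[k] K)).toRingHom

end Forms

/-! ### The element `g_α` -/

section GAlpha

theorem ne_zero_of_not_mem_range {k : Type u} [Field k] {K : Type w} [Field K] [Algebra k K] {α : K}
    (h : α ∉ Set.range (algebraMap k K)) : α ≠ 0 := by
  rintro rfl
  exact h ⟨0, map_zero _⟩

variable {K : Type w} [Field K] [CharZero K]

variable (K) in
/-- The matrix `h₀`. -/
def hZeroMat : Matrix (Fin 7) (Fin 7) K :=
  !![0, -1, 0, 0, 1, 0, 0;
     1/2, 1/2, 0, 0, 1/2, 0, 0;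
     0, 0, 1/2, -1/2, 0, -1/2, -1/2;
     0, 0, 1/2, 1/2, 0, 1/2, -1/2;
     -1/2, 1/2, 0, 0, 1/2, 0, 0;
     0, 0, -1/2, -1/2, 0, 1/2, -1/2;
     0, 0, 1/2, -1/2, 0, 1/2, 1/2]

variable (K) in
/-- The inverse of `h₀`. -/
def hZeroInv : Matrix (Fin 7) (Fin 7) K :=
  !![0, 1, 0, 0, -1, 0, 0;
     -1/2, 1/2, 0, 0, 1/2, 0, 0;
     0, 0, 1/2, 1/2, 0, -1/2, 1/2;
     0, 0, -1/2, 1/2, 0, -1/2, -1/2;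
     1/2, 1/2, 0, 0, 1/2, 0, 0;
     0, 0, -1/2, 1/2, 0, 1/2, 1/2;
     0, 0, -1/2, -1/2, 0, -1/2, 1/2]

theorem hZero_mul_inv : hZeroMat K * hZeroInv K = 1 := by
  ext i j
  fin_cases i <;> fin_cases j <;>
    simp [hZeroMat, hZeroInv, Matrix.mul_apply, Fin.sum_univ_succ] <;> norm_num

variable (K) in
/-- `h₀` as an element of `GL(7)`. -/
def hZero : GL (Fin 7) K :=
  ⟨hZeroMat K, hZeroInv K, hZero_mul_inv, mul_eq_one_comm.mp hZero_mul_inv⟩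

/-- `g_{α,1} = α I₇ · diag(1, α, 1, α⁻¹, α⁻¹, 1, α) · h₀`. -/
def gAlpha1 (α : K) (hα : α ≠ 0) : GL (Fin 7) K :=
  ⟨α • Matrix.diagonal ![1, α, 1, α⁻¹, α⁻¹, 1, α],
   α⁻¹ • Matrix.diagonal ![1, α⁻¹, 1, α, α, 1, α⁻¹],
   by
    rw [Matrix.smul_mul, Matrix.mul_smul, smul_smul, Matrix.diagonal_mul_diagonal,
      mul_inv_cancel₀ hα, one_smul, ← Matrix.diagonal_one]
    congr 1
    ext i
    fin_cases i <;> simp [hα],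
   by
    rw [Matrix.smul_mul, Matrix.mul_smul, smul_smul, Matrix.diagonal_mul_diagonal,
      inv_mul_cancel₀ hα, one_smul, ← Matrix.diagonal_one]
    congr 1
    ext i
    fin_cases i <;> simp [hα]⟩ * hZero K

/-- `g_{α,2}` is the matrix with rows `(1, 1)` and `(α, -α)`. -/
noncomputable def gAlpha2 (α : K) (hα : α ≠ 0) : GL (Fin 2) K :=
  Matrix.GeneralLinearGroup.mkOfDetNeZero !![1, 1; α, -α] (by
    rw [Matrix.det_fin_two_of]
    intro h
    apply hα
    linear_combination (-1 / 2) * h)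

/-- `g_α = (g_{α,1}, g_{α,2})`. -/
noncomputable def gAlpha (α : K) (hα : α ≠ 0) : Amb K := (gAlpha1 α hα, gAlpha2 α hα)

end GAlpha

/-! ### Stabilizers and their identity components -/

section Stabilizer

variable {k : Type u} [Field k]

/-- The `R`-points of the stabilizer `G_x ⊆ G` of a `k`-rational point `x` of `V`. -/
noncomputable def stab (x : V k) (R : Type v) [CommRing R] [Algebra k R] : Subgroup (Amb R) where
  carrier := {g | g ∈ G R ∧ rep R g (x.map (algebraMap k R)) = x.map (algebraMap k R)}
  one_mem' := ⟨one_mem _, by simp⟩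
  mul_mem' := by
    rintro a b ⟨ha, ha'⟩ ⟨hb, hb'⟩
    exact ⟨mul_mem ha hb, by rw [map_mul, Module.End.mul_apply, hb', ha']⟩
  inv_mem' := by
    rintro a ⟨ha, ha'⟩
    refine ⟨inv_mem ha, ?_⟩
    conv_lhs => rw [← ha']
    rw [← Module.End.mul_apply, ← map_mul, inv_mul_cancel, map_one, Module.End.one_apply]

/-- Indices of the matrix coordinates on `GL(7) × GL(2)`. -/
abbrev Coord : Type := (Fin 7 × Fin 7) ⊕ (Fin 2 × Fin 2)

variable (k) in
/-- Evaluation of polynomials in the matrix coordinates at an `R`-point of `GL(7) × GL(2)`. -/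
noncomputable def evalAt {R : Type v} [CommRing R] [Algebra k R] (g : Amb R) :
    MvPolynomial Coord k →ₐ[k] R :=
  MvPolynomial.aeval (Sum.elim (fun p => g.1 p.1 p.2) (fun p => g.2 p.1 p.2))

variable (k) in
/-- The continuous map `Spec R → Spec k[x_ij, y_ij]` attached to an `R`-point `g` of
`GL(7) × GL(2)`. -/
noncomputable def specPoint {R : Type v} [CommRing R] [Algebra k R] (g : Amb R)
    (q : PrimeSpectrum R) : PrimeSpectrum (MvPolynomial Coord k) :=
  PrimeSpectrum.comap (evalAt k g).toRingHom q

/-- The underlying topological space of the `k`-scheme `G_x`, as a subspace of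
`Spec k[x_ij, y_ij]`: the set of images of all field-valued points of `G_x`. As `G_x` is closed in
the open subscheme `GL(7) × GL(2)` of affine space, its Zariski topology is the subspace topology. -/
def stabSpace (x : V k) : Set (PrimeSpectrum (MvPolynomial Coord k)) :=
  {p | ∃ (F : Type u) (_ : Field F) (_ : Algebra k F) (g : Amb F),
    g ∈ stab x F ∧ p = specPoint k g ⊥}

/-- The `R`-points of the identity component `G_x⁰`, the connected component of `1` in `G_x` (an
open subscheme): those `g ∈ G_x(R)` for which `Spec R → G_x` has image in that component. -/
def stabIdentityComponent (x : V k) (R : Type v) [CommRing R] [Algebra k R] : Set (Amb R) :=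
  {g | g ∈ stab x R ∧ ∀ q : PrimeSpectrum R,
    specPoint k g q ∈ connectedComponentIn (stabSpace x) (specPoint k (1 : Amb k) ⊥)}

end Stabilizer

end PrehomG2

open scoped Matrix

namespace PrehomG2

/-! ### Membership in `G₁` in coordinates -/

section Coordinates

variable {R : Type v} [CommRing R]

/-! Over a ring in which 2 is invertible the stabilizer of w is found by linear algebra. If g =
(g_1, g_2) fixes w, then g_1 preserves the span of e_2 and e_5 (one-based), say with block (p q; r
s). Comparing the coordinates of g_1 w̄ and c w̄ shows that e_1 is scaled by a unit u, that the span
of e_3, e_4, e_6, e_7 is preserved, and that sq = rp = 0 and u² = ps + qr (`block_shape`). The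
character χ = c(g_1)² det(g_2)³ then equals (ps + qr)/(ps − qr), so χ² = 1, and χ = 1 forces g =
d(A)(u, u⁻¹) (`stab_wPt_structure`).

Conjugation by g_α carries this to w_α after extending scalars to R(α). The twist comes from two
identities: σ(g_α) = g_α s for the involution s = `swapPair` (`gAlpha_map`), and s⁻¹ d(A) s =
d(θ(A)) with θ(A) = Λ ᵗA⁻¹ Λ (`d_mul_swapPair`). Hence g_α d(A) g_α⁻¹ is σ-invariant exactly when
σ(A) = θ(A), which is the equation of U_α(1,1). Galois descent along R → R(α) identifies the points
with χ = 1 with U_α(1,1) × T̃ (`exists_of_mem_stab`, `exists_mem_stab`).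

It remains to see that χ = 1 cuts out the identity component. As χ² = 1 and 2 is invertible, the
loci χ = 1 and χ = −1 are disjoint, closed and cover the stabilizer, so the component of 1 lies in
the first. Conversely every point with χ = 1 is a specialization of a single point, the image of the
generic point of GL(2) × GL(1) over k(α) (`genericPt_le`), so that locus is irreducible. The passage
to R-points, also for non-reduced R, is `mem_stabIdentityComponent_iff`. -/

/-- The minor of `M` with rows `i, j, l` and columns `a, b, c`. -/
def minorThree (M : Matrix (Fin 7) (Fin 7) R) (i j l a b c : Fin 7) : R :=
  M i a * (M j b * M l c - M j c * M l b) - M i b * (M j a * M l c - M j c * M l a) +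
    M i c * (M j a * M l b - M j b * M l a)

/-- The coordinate of `M w̄` at `e_i ∧ e_j ∧ e_l`. -/
def wCoord (M : Matrix (Fin 7) (Fin 7) R) (i j l : Fin 7) : R :=
  minorThree M i j l 1 2 3 + minorThree M i j l 4 5 6 +
    (minorThree M i j l 0 1 4 + minorThree M i j l 0 2 5 + minorThree M i j l 0 3 6)

theorem map_wCoord {S : Type w} [CommRing S] (f : R →+* S) (M : Matrix (Fin 7) (Fin 7) R)
    (i j l : Fin 7) : wCoord (M.map f) i j l = f (wCoord M i j l) := by
  simp only [wCoord, minorThree, Matrix.map_apply, map_add, map_sub, map_mul]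

variable (R) in
/-- The coordinate of a trivector at `e_{i 0} ∧ e_{i 1} ∧ e_{i 2}`. -/
noncomputable def coordForm (i : Fin 3 → Fin 7) : Module.Dual R (⋀[R]^3 (Fin 7 → R)) :=
  exteriorPower.pairingDual R (Fin 7 → R) 3
    (exteriorPower.ιMulti R 3 fun j => (LinearMap.proj (i j) : (Fin 7 → R) →ₗ[R] R))

theorem coordForm_map_tri (M : Matrix (Fin 7) (Fin 7) R) (i : Fin 3 → Fin 7) (a b c : Fin 7) :
    coordForm R i (exteriorPower.map 3 (Matrix.mulVecLin M) (tri R a b c)) =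
      minorThree M (i 0) (i 1) (i 2) a b c := by
  rw [tri, exteriorPower.map_apply_ιMulti, coordForm, exteriorPower.pairingDual_ιMulti_ιMulti,
    Matrix.det_fin_three]
  simp [e, minorThree]
  ring

theorem coordForm_map_wBar (M : Matrix (Fin 7) (Fin 7) R) (i : Fin 3 → Fin 7) :
    coordForm R i (exteriorPower.map 3 (Matrix.mulVecLin M) (wBar R)) =
      wCoord M (i 0) (i 1) (i 2) := by
  simp only [wBar, map_add, coordForm_map_tri, wCoord]

theorem coordForm_wBar (i : Fin 3 → Fin 7) :
    coordForm R i (wBar R) = wCoord (1 : Matrix (Fin 7) (Fin 7) R) (i 0) (i 1) (i 2) := by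
  rw [← coordForm_map_wBar]
  simp

theorem trivector_ext {x y : ⋀[R]^3 (Fin 7 → R)} (h : ∀ i, StrictMono i →
    coordForm R i x = coordForm R i y) :
    x = y := by
  refine ((Pi.basisFun R (Fin 7)).exteriorPower 3).ext_elem fun s => ?_
  rw [exteriorPower.basis_repr_apply, exteriorPower.basis_repr_apply]
  have key : exteriorPower.ιMultiDual R 3 (Pi.basisFun R (Fin 7)) s =
      coordForm R (Set.powersetCard.ofFinEmbEquiv.symm s) := by
    rw [exteriorPower.ιMultiDual, coordForm, exteriorPower.ιMulti_family]
    congr 2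
  rw [key, h _ (Set.powersetCard.ofFinEmbEquiv.symm s).strictMono]

theorem wCoord_one_one_two_three : wCoord (1 : Matrix (Fin 7) (Fin 7) R) 1 2 3 = 1 := by
  simp [wCoord, minorThree]

/-- The scalar need not be assumed a unit: applying g⁻¹ to g w̄ = c w̄ and reading the coordinate of
w̄ that equals 1 exhibits an inverse of c. Increasing triples suffice because they index a basis of
∧³. -/
theorem mem_G1_of_lt {g : GL (Fin 7) R} {c : R}
    (hc : ∀ i j l, i < j → j < l → wCoord (g : Matrix (Fin 7) (Fin 7) R) i j l =
      c * wCoord (1 : Matrix (Fin 7) (Fin 7) R) i j l) : g ∈ G1 R := by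
  have h : exteriorPower.map 3 (Matrix.mulVecLin (g : Matrix (Fin 7) (Fin 7) R)) (wBar R) =
      c • wBar R := by
    refine trivector_ext fun i hi => ?_
    rw [coordForm_map_wBar, map_smul, coordForm_wBar,
      hc _ _ _ (hi (by decide)) (hi (by decide)), smul_eq_mul]
  have h1 : exteriorPower.map 3 (Matrix.mulVecLin ((g⁻¹ : GL (Fin 7) R) :
      Matrix (Fin 7) (Fin 7) R)) (exteriorPower.map 3
        (Matrix.mulVecLin (g : Matrix (Fin 7) (Fin 7) R)) (wBar R)) = wBar R := by
    rw [← LinearMap.comp_apply, ← exteriorPower.map_comp, ← Matrix.mulVecLin_mul,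
      ← Units.val_mul, inv_mul_cancel]
    simp
  rw [h, map_smul] at h1
  have h2 := congrArg (coordForm R ![1, 2, 3]) h1
  rw [map_smul, coordForm_map_wBar, coordForm_wBar] at h2
  have h3 : IsUnit c := IsUnit.of_mul_eq_one _ (h2.trans wCoord_one_one_two_three)
  exact ⟨h3.unit, h⟩

/-- The coordinate of w̄ at e_234 (one-based) is 1, so the multiplier is itself a coordinate of g
w̄, that is, a polynomial in the entries of g. -/
theorem isUnit_wCoord {g : GL (Fin 7) R} (hg : g ∈ G1 R) :
    IsUnit (wCoord (g : Matrix (Fin 7) (Fin 7) R) 1 2 3) ∧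
    ∀ i j l, wCoord (g : Matrix (Fin 7) (Fin 7) R) i j l =
      wCoord (g : Matrix (Fin 7) (Fin 7) R) 1 2 3 *
        wCoord (1 : Matrix (Fin 7) (Fin 7) R) i j l := by
  obtain ⟨c, hc⟩ := hg
  have h : ∀ i j l, wCoord (g : Matrix (Fin 7) (Fin 7) R) i j l =
      c * wCoord (1 : Matrix (Fin 7) (Fin 7) R) i j l := fun i j l => by
    have h := congrArg (coordForm R ![i, j, l]) hc
    rw [coordForm_map_wBar, map_smul, coordForm_wBar] at h
    exact h
  have h123 := h 1 2 3
  rw [wCoord_one_one_two_three, mul_one] at h123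
  rw [h123]
  exact ⟨c.isUnit, h⟩

theorem mem_G1_iff (g : GL (Fin 7) R) :
    g ∈ G1 R ↔ ∃ c : R, ∀ i j l, wCoord (g : Matrix (Fin 7) (Fin 7) R) i j l =
      c * wCoord (1 : Matrix (Fin 7) (Fin 7) R) i j l :=
  ⟨fun hg => ⟨_, (isUnit_wCoord hg).2⟩, fun ⟨_, hc⟩ => mem_G1_of_lt fun i j l _ _ => hc i j l⟩

/-- Since the multiplier is a polynomial in the entries, belonging to G₁ is a system of polynomial
equations, and equations descend along an injection. -/
theorem mem_G1_of_map {S : Type w} [CommRing S] {f : R →+* S} (hf : Function.Injective f)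
    {g : GL (Fin 7) R} (hg : Matrix.GeneralLinearGroup.map f g ∈ G1 S) : g ∈ G1 R := by
  obtain ⟨c, hc⟩ := (mem_G1_iff _).mp hg
  have hmap : ∀ i j l, wCoord ((Matrix.GeneralLinearGroup.map f g : GL (Fin 7) S) :
      Matrix (Fin 7) (Fin 7) S) i j l = f (wCoord (g : Matrix (Fin 7) (Fin 7) R) i j l) :=
    fun i j l => map_wCoord f _ i j l
  have hone : ∀ i j l, wCoord (1 : Matrix (Fin 7) (Fin 7) S) i j l =
      f (wCoord (1 : Matrix (Fin 7) (Fin 7) R) i j l) := fun i j l => by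
    rw [← map_wCoord]
    simp
  refine (mem_G1_iff g).mpr ⟨wCoord (g : Matrix (Fin 7) (Fin 7) R) 1 2 3, fun i j l => hf ?_⟩
  have h123 := hc 1 2 3
  rw [wCoord_one_one_two_three, mul_one] at h123
  rw [map_mul, ← hmap, ← hmap, ← hone, hc, h123]

theorem Amb.mem_G_iff (g : Amb R) : g ∈ G R ↔ g.1 ∈ G1 R := by
  simp [G, Subgroup.mem_prod]

theorem G_map {S : Type w} [CommRing S] (f : R →+* S) {g : Amb R} (hg : g ∈ G R) :
    Amb.map f g ∈ G S :=
  (Amb.mem_G_iff _).mpr (G1_map f ((Amb.mem_G_iff g).mp hg))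

theorem mem_G_of_map {S : Type w} [CommRing S] {f : R →+* S} (hf : Function.Injective f)
    {g : Amb R} (hg : Amb.map f g ∈ G S) : g ∈ G R := by
  have h : Matrix.GeneralLinearGroup.map f g.1 ∈ G1 S := (Amb.mem_G_iff (Amb.map f g)).mp hg
  exact (Amb.mem_G_iff g).mpr (mem_G1_of_map hf h)

theorem rep_apply (g : Amb R) (x : V R) : rep R g x = (g.1 : Matrix (Fin 7) (Fin 7) R) * x *
    (g.2 : Matrix (Fin 2) (Fin 2) R).transpose := rfl

theorem Amb.map_fst {S : Type w} [CommRing S] (f : R →+* S) (g : Amb R) :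
    ((Amb.map f g).1 : Matrix (Fin 7) (Fin 7) S) = (g.1 : Matrix (Fin 7) (Fin 7) R).map f := rfl

theorem Amb.map_snd {S : Type w} [CommRing S] (f : R →+* S) (g : Amb R) :
    ((Amb.map f g).2 : Matrix (Fin 2) (Fin 2) S) = (g.2 : Matrix (Fin 2) (Fin 2) R).map f := rfl

theorem Amb.ext {g h : Amb R} (h1 : (g.1 : Matrix (Fin 7) (Fin 7) R) = h.1)
    (h2 : (g.2 : Matrix (Fin 2) (Fin 2) R) = h.2) : g = h :=
  Prod.ext (Units.ext h1) (Units.ext h2)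

theorem rep_map {S : Type w} [CommRing S] (f : R →+* S) (g : Amb R) (x : V R) :
    rep S (Amb.map f g) (x.map f) = (rep R g x).map f := by
  rw [rep_apply, rep_apply, Amb.map_fst, Amb.map_snd, Matrix.map_mul, Matrix.map_mul,
    Matrix.transpose_map]

theorem wPt_map {S : Type w} [CommRing S] (f : R →+* S) : (wPt R).map f = wPt S := by
  ext i j
  fin_cases j <;> simp [wPt, e, Pi.single_apply, apply_ite f]

theorem Amb.map_injective {S : Type w} [CommRing S] {f : R →+* S} (hf : Function.Injective f) :
    Function.Injective (Amb.map f) := by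
  intro g h hgh
  refine Amb.ext (Matrix.map_injective hf ?_) (Matrix.map_injective hf ?_)
  · exact congrArg (fun x : Amb S => (x.1 : Matrix (Fin 7) (Fin 7) S)) hgh
  · exact congrArg (fun x : Amb S => (x.2 : Matrix (Fin 2) (Fin 2) S)) hgh

end Coordinates

/-! ### The stabilizer of `w` over a ring in which `2` is invertible -/

section Structure

variable {R : Type v} [CommRing R]

/-- The exterior square of `N` on the coordinates `(i, j)` and `(a, b)`. -/
def minorTwo (M : Matrix (Fin 7) (Fin 7) R) (i j a b : Fin 7) : R := M i a * M j b - M j a * M i b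

/-- The coordinate at `e_i ∧ e_j` of the image under `M` of `ω = e_{36} + e_{47}` (one-based). -/
def symCoord (M : Matrix (Fin 7) (Fin 7) R) (i j : Fin 7) : R :=
  minorTwo M i j 2 5 + minorTwo M i j 3 6

/-- Modulo the span of the zero-based e_1, e_4 the hypothesis reads x ∧ Mω = c e_0 ∧ ω, where x is
the image of e_0. Wedging with x gives c x ∧ e_0 ∧ ω = 0, whose coordinates are, up to sign, c times
the four entries of x in question. -/
theorem first_column {M : Matrix (Fin 7) (Fin 7) R} {c : R}
    (hE : ∀ i j l, wCoord M i j l = c * wCoord (1 : Matrix (Fin 7) (Fin 7) R) i j l)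
    (h1 : ∀ i, i ≠ 1 → i ≠ 4 → M i 1 = 0) (h4 : ∀ i, i ≠ 1 → i ≠ 4 → M i 4 = 0)
    (hc : IsUnit c) : M 2 0 = 0 ∧ M 3 0 = 0 ∧ M 5 0 = 0 ∧ M 6 0 = 0 := by
  have z01 := h1 0 (by decide) (by decide)
  have z21 := h1 2 (by decide) (by decide)
  have z31 := h1 3 (by decide) (by decide)
  have z51 := h1 5 (by decide) (by decide)
  have z61 := h1 6 (by decide) (by decide)
  have z04 := h4 0 (by decide) (by decide)
  have z24 := h4 2 (by decide) (by decide)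
  have z34 := h4 3 (by decide) (by decide)
  have z54 := h4 5 (by decide) (by decide)
  have z64 := h4 6 (by decide) (by decide)
  have e023 := hE 0 2 3
  have e025 := hE 0 2 5
  have e026 := hE 0 2 6
  have e035 := hE 0 3 5
  have e036 := hE 0 3 6
  have e056 := hE 0 5 6
  have e235 := hE 2 3 5
  have e236 := hE 2 3 6
  have e256 := hE 2 5 6
  have e356 := hE 3 5 6
  simp [wCoord, minorThree, z01, z21, z31, z51, z61, z04, z24, z34, z54, z64]
    at e023 e025 e026 e035 e036 e056 e235 e236 e256 e356
  refine ⟨?_, ?_, ?_, ?_⟩ <;> refine hc.mul_right_eq_zero.mp ?_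
  · linear_combination M 0 0 * e236 - M 2 0 * e036 + M 3 0 * e026 - M 6 0 * e023
  · linear_combination -(M 0 0 * e235 - M 2 0 * e035 + M 3 0 * e025 - M 5 0 * e023)
  · linear_combination -(M 0 0 * e356 - M 3 0 * e056 + M 5 0 * e036 - M 6 0 * e035)
  · linear_combination (M 0 0 * e256 - M 2 0 * e056 + M 5 0 * e026 - M 6 0 * e025)

/-- Let U be the span of the zero-based e_2, e_3, e_5, e_6. The component of M w̄ in e_a ∧ ∧²U, for
a = 0, 1, 4, is a combination of the images of ω, e_23 and e_56 with the entries of row a as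
coefficients. -/
theorem symCoord_column {M : Matrix (Fin 7) (Fin 7) R} {c : R}
    (hE : ∀ i j l, wCoord M i j l = c * wCoord (1 : Matrix (Fin 7) (Fin 7) R) i j l)
    (h1 : ∀ i, i ≠ 1 → i ≠ 4 → M i 1 = 0) (h4 : ∀ i, i ≠ 1 → i ≠ 4 → M i 4 = 0)
    (h0 : ∀ i, i ≠ 0 → i ≠ 1 → i ≠ 4 → M i 0 = 0) {i j : Fin 7}
    (hi : i ≠ 0 ∧ i ≠ 1 ∧ i ≠ 4) (hj : j ≠ 0 ∧ j ≠ 1 ∧ j ≠ 4) :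
    M 0 0 * symCoord M i j = c * wCoord (1 : Matrix (Fin 7) (Fin 7) R) 0 i j ∧
    M 1 0 * symCoord M i j + M 1 1 * minorTwo M i j 2 3 + M 1 4 * minorTwo M i j 5 6 =
      c * wCoord (1 : Matrix (Fin 7) (Fin 7) R) 1 i j ∧
    M 4 0 * symCoord M i j + M 4 1 * minorTwo M i j 2 3 + M 4 4 * minorTwo M i j 5 6 =
      c * wCoord (1 : Matrix (Fin 7) (Fin 7) R) 4 i j := by
  rw [← hE, ← hE, ← hE]
  simp only [wCoord, minorThree, symCoord, minorTwo, h1 0 (by decide) (by decide),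
    h4 0 (by decide) (by decide), h1 i hi.2.1 hi.2.2, h4 i hi.2.1 hi.2.2, h0 i hi.1 hi.2.1 hi.2.2,
    h1 j hj.2.1 hj.2.2, h4 j hj.2.1 hj.2.2, h0 j hj.1 hj.2.1 hj.2.2]
  refine ⟨?_, ?_, ?_⟩ <;> ring

/-- The relations among the images of `ω, e_{34}, e_{67}` under a linear map of a four-dimensional
space, given by their coordinates `w, A, B`. -/
theorem bivector_relations {u c a b p q r s w23 w25 w26 w35 w36 w56 A23 A25 A26 A35 A36 A56
    B23 B25 B26 B35 B36 B56 : R} (h2 : IsUnit (2 : R)) (hc : IsUnit c)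
    (hm : IsUnit (p * s - q * r))
    (k23 : u * w23 = 0) (k25 : u * w25 = c) (k26 : u * w26 = 0) (k35 : u * w35 = 0)
    (k36 : u * w36 = c) (k56 : u * w56 = 0)
    (a23 : a * w23 + p * A23 + q * B23 = c) (a25 : a * w25 + p * A25 + q * B25 = 0)
    (a26 : a * w26 + p * A26 + q * B26 = 0) (a35 : a * w35 + p * A35 + q * B35 = 0)
    (a36 : a * w36 + p * A36 + q * B36 = 0) (a56 : a * w56 + p * A56 + q * B56 = 0)
    (b23 : b * w23 + r * A23 + s * B23 = 0) (b25 : b * w25 + r * A25 + s * B25 = 0)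
    (b26 : b * w26 + r * A26 + s * B26 = 0) (b35 : b * w35 + r * A35 + s * B35 = 0)
    (b36 : b * w36 + r * A36 + s * B36 = 0) (b56 : b * w56 + r * A56 + s * B56 = c)
    (wA : w23 * A56 - w25 * A36 + w26 * A35 + w35 * A26 - w36 * A25 + w56 * A23 = 0)
    (wB : w23 * B56 - w25 * B36 + w26 * B35 + w35 * B26 - w36 * B25 + w56 * B23 = 0)
    (AA : A23 * A56 - A25 * A36 + A26 * A35 = 0) (BB : B23 * B56 - B25 * B36 + B26 * B35 = 0)
    (ww : w23 * w56 - w25 * w36 + w26 * w35 + (A23 * B56 - A25 * B36 + A26 * B35 + A35 * B26 -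
      A36 * B25 + A56 * B23) = 0) :
    (a = 0 ∧ b = 0) ∧ (IsUnit u ∧ w23 = 0 ∧ w26 = 0 ∧ w35 = 0 ∧ w56 = 0 ∧ w25 = w36) ∧
    (s * q = 0 ∧ r * p = 0 ∧ u ^ 2 = p * s + q * r) ∧
    (A25 = 0 ∧ A26 = 0 ∧ A35 = 0 ∧ A36 = 0 ∧ B25 = 0 ∧ B26 = 0 ∧ B35 = 0 ∧ B36 = 0) ∧
    ((p * s - q * r) * A23 = c * s ∧ (p * s - q * r) * A56 = -(c * q) ∧
      (p * s - q * r) * B23 = -(c * r) ∧ (p * s - q * r) * B56 = c * p) := by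
  have hu : IsUnit u := isUnit_of_mul_isUnit_left (k25 ▸ hc)
  have hw : IsUnit w25 := isUnit_of_mul_isUnit_right (k25 ▸ hc)
  have w23z := hu.mul_right_eq_zero.mp k23
  have w26z := hu.mul_right_eq_zero.mp k26
  have w35z := hu.mul_right_eq_zero.mp k35
  have w56z := hu.mul_right_eq_zero.mp k56
  have w36e : w25 = w36 := hu.mul_left_cancel (k25.trans k36.symm)
  subst w23z w26z w35z w56z w36e
  -- The hypotheses `wA`, `wB`, `AA`, `BB`, `ww` are the wedge relations among ω, e_34, e_67
  -- (one-based), transported by the linear map. As w is now a unit multiple of ω, the first two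
  -- become trace conditions.
  have sA : A25 + A36 = 0 := hw.mul_right_eq_zero.mp (by linear_combination -wA)
  have sB : B25 + B36 = 0 := hw.mul_right_eq_zero.mp (by linear_combination -wB)
  -- Adding the equations at the two pairs occurring in ω leaves 2·a·w25 = 0; this is where 2 must
  -- be invertible.
  have az : a = 0 := (h2.mul hw).mul_left_eq_zero.mp
    (by linear_combination a25 + a36 - p * sA - q * sB)
  have bz : b = 0 := (h2.mul hw).mul_left_eq_zero.mp
    (by linear_combination b25 + b36 - r * sA - s * sB)
  subst az bz
  have solveA : ∀ {x y : R}, p * x + q * y = 0 → r * x + s * y = 0 → x = 0 := fun h h' =>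
    hm.mul_right_eq_zero.mp (by linear_combination s * h - q * h')
  have solveB : ∀ {x y : R}, p * x + q * y = 0 → r * x + s * y = 0 → y = 0 := fun h h' =>
    hm.mul_right_eq_zero.mp (by linear_combination p * h' - r * h)
  simp only [zero_mul, mul_zero, zero_add] at *
  have A25z := solveA a25 b25
  have A26z := solveA a26 b26
  have A35z := solveA a35 b35
  have A36z := solveA a36 b36
  have B25z := solveB a25 b25
  have B26z := solveB a26 b26
  have B35z := solveB a35 b35
  have B36z := solveB a36 b36
  subst A25z A26z A35z A36z B25z B26z B35z B36z
  have eA23 : (p * s - q * r) * A23 = c * s := by linear_combination s * a23 - q * b23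
  have eA56 : (p * s - q * r) * A56 = -(c * q) := by linear_combination s * a56 - q * b56
  have eB23 : (p * s - q * r) * B23 = -(c * r) := by linear_combination p * b23 - r * a23
  have eB56 : (p * s - q * r) * B56 = c * p := by linear_combination p * b56 - r * a56
  -- The bivector A is proportional to (s, −q) in its two remaining coordinates, so A ∧ A = 0 says
  -- sq = 0; likewise B for rp.
  have sq : s * q = 0 := (hc.pow 2).mul_right_eq_zero.mp (by
    linear_combination -(p * s - q * r) ^ 2 * AA + (p * s - q * r) * A56 * eA23 + c * s * eA56)
  have rp : r * p = 0 := (hc.pow 2).mul_right_eq_zero.mp (by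
    linear_combination -(p * s - q * r) ^ 2 * BB + (p * s - q * r) * B56 * eB23 - c * r * eB56)
  have hsq : (p * s + q * r) ^ 2 = (p * s - q * r) ^ 2 := by
    linear_combination 4 * r * p * sq
  have hun : IsUnit (p * s + q * r) := by
    refine (isUnit_pow_iff (two_ne_zero)).mp (?_ : IsUnit ((p * s + q * r) ^ 2))
    rw [hsq]
    exact hm.pow 2
  -- This is `ww` after A, B and w have been expressed through c, u and the 2×2 block. Since pqrs =
  -- 0, the right side is also (ps + qr)², and cancelling a factor gives u².
  have key : u ^ 2 * (p * s + q * r) = (p * s - q * r) ^ 2 := by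
    refine (hc.pow 2).mul_left_cancel ?_
    have t1 : c ^ 2 * (p * s + q * r) = (p * s - q * r) ^ 2 * w25 ^ 2 := by
      linear_combination (p * s - q * r) ^ 2 * ww - (p * s - q * r) * B56 * eA23 - c * s * eB56
        - (p * s - q * r) * B23 * eA56 + c * q * eB23
    have t2 : u ^ 2 * w25 ^ 2 = c ^ 2 := by linear_combination (u * w25 + c) * k25
    linear_combination u ^ 2 * t1 + (p * s - q * r) ^ 2 * t2
  refine ⟨by simp, ⟨hu, by simp⟩, ⟨sq, rp, ?_⟩, by simp, eA23, eA56, eB23, eB56⟩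
  refine hun.mul_right_cancel ?_
  rw [key, ← hsq, pow_two]

/-- A linear map of a four-dimensional space preserving a symplectic form up to a unit is
injective. -/
theorem symplectic_injective {M : Matrix (Fin 7) (Fin 7) R} {w : R} (hw : IsUnit w)
    (w23 : symCoord M 2 3 = 0) (w26 : symCoord M 2 6 = 0) (w35 : symCoord M 3 5 = 0)
    (w56 : symCoord M 5 6 = 0) (w25 : symCoord M 2 5 = w) (w36 : symCoord M 3 6 = w)
    {y2 y3 y5 y6 : R} (hy : ∀ i : Fin 7, i ≠ 0 ∧ i ≠ 1 ∧ i ≠ 4 →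
      M i 2 * y2 + M i 3 * y3 + M i 5 * y5 + M i 6 * y6 = 0) :
    y2 = 0 ∧ y3 = 0 ∧ y5 = 0 ∧ y6 = 0 := by
  obtain ⟨v, hv⟩ := hw.exists_right_inv
  -- The inverse is the symplectic adjoint of the 4×4 block divided by the multiplier w.
  have hNX : !![M 2 2, M 2 3, M 2 5, M 2 6; M 3 2, M 3 3, M 3 5, M 3 6;
      M 5 2, M 5 3, M 5 5, M 5 6; M 6 2, M 6 3, M 6 5, M 6 6] *
      (v • !![M 5 5, M 6 5, -M 2 5, -M 3 5; M 5 6, M 6 6, -M 2 6, -M 3 6;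
        -M 5 2, -M 6 2, M 2 2, M 3 2; -M 5 3, -M 6 3, M 2 3, M 3 3]) = 1 := by
    simp only [symCoord, minorTwo] at w23 w26 w35 w56 w25 w36
    ext i j
    fin_cases i <;> fin_cases j <;> simp [Matrix.mul_apply, Fin.sum_univ_four] <;>
    first
    | ring1
    | linear_combination v * w25 + hv
    | linear_combination v * w36 + hv
    | linear_combination v * w23
    | linear_combination v * w26
    | linear_combination v * w35
    | linear_combination v * w56
    | linear_combination -v * w23
    | linear_combination -v * w26
    | linear_combination -v * w35
    | linear_combination -v * w56
  have hN0 : !![M 2 2, M 2 3, M 2 5, M 2 6; M 3 2, M 3 3, M 3 5, M 3 6;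
      M 5 2, M 5 3, M 5 5, M 5 6; M 6 2, M 6 3, M 6 5, M 6 6] *ᵥ ![y2, y3, y5, y6] = 0 := by
    ext i
    fin_cases i
    · simpa [Matrix.mulVec, dotProduct, Fin.sum_univ_four] using hy 2 (by decide)
    · simpa [Matrix.mulVec, dotProduct, Fin.sum_univ_four] using hy 3 (by decide)
    · simpa [Matrix.mulVec, dotProduct, Fin.sum_univ_four] using hy 5 (by decide)
    · simpa [Matrix.mulVec, dotProduct, Fin.sum_univ_four] using hy 6 (by decide)
  have h := Matrix.one_mulVec ![y2, y3, y5, y6]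
  rw [← mul_eq_one_comm.mp hNX, ← Matrix.mulVec_mulVec, hN0, Matrix.mulVec_zero] at h
  exact ⟨(congrFun h 0).symm, (congrFun h 1).symm, (congrFun h 2).symm, (congrFun h 3).symm⟩

/-- The shape of an element of `G₁` preserving the span of `e₂` and `e₅`. -/
theorem block_shape {M : Matrix (Fin 7) (Fin 7) R} {c : R} (h2 : IsUnit (2 : R)) (hc : IsUnit c)
    (hE : ∀ i j l, wCoord M i j l = c * wCoord (1 : Matrix (Fin 7) (Fin 7) R) i j l)
    (h1 : ∀ i, i ≠ 1 → i ≠ 4 → M i 1 = 0) (h4 : ∀ i, i ≠ 1 → i ≠ 4 → M i 4 = 0)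
    (hm : IsUnit (M 1 1 * M 4 4 - M 1 4 * M 4 1)) :
    (∀ i, i ≠ 0 → M i 0 = 0) ∧
    (∀ i, i ≠ 0 ∧ i ≠ 1 ∧ i ≠ 4 → M 0 i = 0 ∧ M 1 i = 0 ∧ M 4 i = 0) ∧
    (M 4 4 * M 1 4 = 0 ∧ M 4 1 * M 1 1 = 0 ∧ M 0 0 ^ 2 = M 1 1 * M 4 4 + M 1 4 * M 4 1) ∧
    c = M 0 0 * (M 1 1 * M 4 4 - M 1 4 * M 4 1) ∧ IsUnit (M 0 0) ∧
    (minorTwo M 2 3 2 3 = M 0 0 * M 4 4 ∧ minorTwo M 2 5 2 3 = 0 ∧ minorTwo M 2 6 2 3 = 0 ∧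
      minorTwo M 3 5 2 3 = 0 ∧ minorTwo M 3 6 2 3 = 0 ∧
      minorTwo M 5 6 2 3 = -(M 0 0 * M 1 4)) ∧
    (minorTwo M 2 3 5 6 = -(M 0 0 * M 4 1) ∧ minorTwo M 2 5 5 6 = 0 ∧ minorTwo M 2 6 5 6 = 0 ∧
      minorTwo M 3 5 5 6 = 0 ∧ minorTwo M 3 6 5 6 = 0 ∧ minorTwo M 5 6 5 6 = M 0 0 * M 1 1) ∧
    (symCoord M 2 3 = 0 ∧ symCoord M 2 6 = 0 ∧ symCoord M 3 5 = 0 ∧ symCoord M 5 6 = 0 ∧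
      symCoord M 2 5 = M 1 1 * M 4 4 - M 1 4 * M 4 1 ∧
      symCoord M 3 6 = M 1 1 * M 4 4 - M 1 4 * M 4 1) := by
  obtain ⟨z2, z3, z5, z6⟩ := first_column hE h1 h4 hc
  have h0 : ∀ i, i ≠ 0 → i ≠ 1 → i ≠ 4 → M i 0 = 0 := by
    intro i i0 i1 i4
    fin_cases i <;> simp at i0 i1 i4 <;> assumption
  have hS := fun (i j : Fin 7) => @symCoord_column R _ M c hE h1 h4 h0 i j
  obtain ⟨k23, a23, b23⟩ := hS 2 3 (by decide) (by decide)
  obtain ⟨k25, a25, b25⟩ := hS 2 5 (by decide) (by decide)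
  obtain ⟨k26, a26, b26⟩ := hS 2 6 (by decide) (by decide)
  obtain ⟨k35, a35, b35⟩ := hS 3 5 (by decide) (by decide)
  obtain ⟨k36, a36, b36⟩ := hS 3 6 (by decide) (by decide)
  obtain ⟨k56, a56, b56⟩ := hS 5 6 (by decide) (by decide)
  have rel := @bivector_relations R _ (M 0 0) c (M 1 0) (M 4 0) (M 1 1) (M 1 4) (M 4 1) (M 4 4)
    (symCoord M 2 3) (symCoord M 2 5) (symCoord M 2 6) (symCoord M 3 5) (symCoord M 3 6)
    (symCoord M 5 6) (minorTwo M 2 3 2 3) (minorTwo M 2 5 2 3) (minorTwo M 2 6 2 3)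
    (minorTwo M 3 5 2 3) (minorTwo M 3 6 2 3) (minorTwo M 5 6 2 3) (minorTwo M 2 3 5 6)
    (minorTwo M 2 5 5 6) (minorTwo M 2 6 5 6) (minorTwo M 3 5 5 6) (minorTwo M 3 6 5 6)
    (minorTwo M 5 6 5 6) h2 hc hm
  simp [wCoord, minorThree]
    at k23 k25 k26 k35 k36 k56 a23 a25 a26 a35 a36 a56 b23 b25 b26 b35 b36 b56
  obtain ⟨⟨az, bz⟩, ⟨hu, w23, w26, w35, w56, w25⟩, ⟨sq, rp, hu2⟩,
      ⟨A25, A26, A35, A36, B25, B26, B35, B36⟩, A23, A56, B23, B56⟩ :=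
    rel k23 k25 k26 k35 k36 k56 a23 a25 a26 a35 a36 a56 b23 b25 b26 b35 b36 b56
      (by simp only [symCoord, minorTwo]; ring) (by simp only [symCoord, minorTwo]; ring)
      (by simp only [minorTwo]; ring) (by simp only [minorTwo]; ring)
      (by simp only [symCoord, minorTwo]; ring)
  clear rel a23 a25 a26 a35 a36 a56 b23 b25 b26 b35 b36 b56
  have hw : IsUnit (symCoord M 2 5) := isUnit_of_mul_isUnit_right (k25 ▸ hc)
  have inj := @symplectic_injective R _ M _ hw w23 w26 w35 w56 rfl w25.symm
  have h00 : M 0 1 = 0 ∧ M 0 4 = 0 := ⟨h1 0 (by decide) (by decide), h4 0 (by decide) (by decide)⟩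
  -- As i runs over the four remaining indices, the coordinates at (0, 1, i) say that the invertible
  -- 4×4 block kills one explicit vector; (0, 4, i) and (1, 4, i) give two more.
  obtain ⟨x1, x2, x3, x4⟩ := @inj (-(M 0 0 * M 1 5) + M 1 1 * M 0 3)
      (-(M 0 0 * M 1 6) - M 1 1 * M 0 2) (M 0 0 * M 1 2 + M 1 4 * M 0 6)
      (M 0 0 * M 1 3 - M 1 4 * M 0 5) (by
    intro i hi
    have E := hE 0 1 i
    rw [show wCoord (1 : Matrix (Fin 7) (Fin 7) R) 0 1 i = 0 by
      fin_cases i <;> simp [wCoord, minorThree] at hi ⊢] at E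
    simp only [wCoord, minorThree, h1 i hi.2.1 hi.2.2, h4 i hi.2.1 hi.2.2, h0 i hi.1 hi.2.1 hi.2.2,
      h00, az] at E
    linear_combination E)
  obtain ⟨y1, y2, y3, y4⟩ := @inj (-(M 0 0 * M 4 5) + M 4 1 * M 0 3)
      (-(M 0 0 * M 4 6) - M 4 1 * M 0 2) (M 0 0 * M 4 2 + M 4 4 * M 0 6)
      (M 0 0 * M 4 3 - M 4 4 * M 0 5) (by
    intro i hi
    have E := hE 0 4 i
    rw [show wCoord (1 : Matrix (Fin 7) (Fin 7) R) 0 4 i = 0 by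
      fin_cases i <;> simp [wCoord, minorThree] at hi ⊢] at E
    simp only [wCoord, minorThree, h1 i hi.2.1 hi.2.2, h4 i hi.2.1 hi.2.2, h0 i hi.1 hi.2.1 hi.2.2,
      h00, bz] at E
    linear_combination E)
  obtain ⟨t1, t2, t3, t4⟩ := @inj (-(M 1 1 * M 4 3 - M 4 1 * M 1 3))
      (M 1 1 * M 4 2 - M 4 1 * M 1 2) (-(M 1 4 * M 4 6 - M 4 4 * M 1 6))
      (M 1 4 * M 4 5 - M 4 4 * M 1 5) (by
    intro i hi
    have E := hE 1 4 i
    rw [show wCoord (1 : Matrix (Fin 7) (Fin 7) R) 1 4 i = 0 by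
      fin_cases i <;> simp [wCoord, minorThree] at hi ⊢] at E
    simp only [wCoord, minorThree, h1 i hi.2.1 hi.2.2, h4 i hi.2.1 hi.2.2, h0 i hi.1 hi.2.1 hi.2.2,
      az, bz] at E
    linear_combination E)
  -- Eliminating rows 1 and 4 from the three vanishing vectors leaves the determinant of the 2×2
  -- block times an entry of row 0.
  have l2 : M 0 2 = 0 := hm.mul_right_eq_zero.mp (by
    linear_combination -M 0 0 * t3 + M 1 4 * y2 - M 4 4 * x2)
  have l3 : M 0 3 = 0 := hm.mul_right_eq_zero.mp (by
    linear_combination -M 0 0 * t4 - M 1 4 * y1 + M 4 4 * x1)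
  have l5 : M 0 5 = 0 := hm.mul_right_eq_zero.mp (by
    linear_combination -M 0 0 * t1 - M 1 1 * y4 + M 4 1 * x4)
  have l6 : M 0 6 = 0 := hm.mul_right_eq_zero.mp (by
    linear_combination -M 0 0 * t2 + M 1 1 * y3 - M 4 1 * x3)
  have f12 : M 1 2 = 0 := hu.mul_right_eq_zero.mp (by linear_combination x3 - M 1 4 * l6)
  have f13 : M 1 3 = 0 := hu.mul_right_eq_zero.mp (by linear_combination x4 + M 1 4 * l5)
  have f15 : M 1 5 = 0 := hu.mul_right_eq_zero.mp (by linear_combination -x1 + M 1 1 * l3)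
  have f16 : M 1 6 = 0 := hu.mul_right_eq_zero.mp (by linear_combination -x2 - M 1 1 * l2)
  have f42 : M 4 2 = 0 := hu.mul_right_eq_zero.mp (by linear_combination y3 - M 4 4 * l6)
  have f43 : M 4 3 = 0 := hu.mul_right_eq_zero.mp (by linear_combination y4 + M 4 4 * l5)
  have f45 : M 4 5 = 0 := hu.mul_right_eq_zero.mp (by linear_combination -y1 + M 4 1 * l3)
  have f46 : M 4 6 = 0 := hu.mul_right_eq_zero.mp (by linear_combination -y2 - M 4 1 * l2)
  -- With the off-block entries gone, only the minor with columns 0, 1, 4 contributes to the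
  -- coordinate at (0, 1, 4).
  have hcu : c = M 0 0 * (M 1 1 * M 4 4 - M 1 4 * M 4 1) := by
    have E := hE 0 1 4
    rw [show wCoord (1 : Matrix (Fin 7) (Fin 7) R) 0 1 4 = 1 by simp [wCoord, minorThree]] at E
    simp only [wCoord, minorThree, h00, az, bz, l2, l3, l5, l6, f12, f13, f42, f43] at E
    linear_combination -E
  have hw25 : symCoord M 2 5 = M 1 1 * M 4 4 - M 1 4 * M 4 1 :=
    hu.mul_left_cancel (k25.trans hcu)
  refine ⟨?_, ?_, ⟨sq, rp, hu2⟩, hcu, hu, ⟨hm.mul_left_cancel ?_, A25, A26, A35, A36,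
    hm.mul_left_cancel ?_⟩, ⟨hm.mul_left_cancel ?_, B25, B26, B35, B36, hm.mul_left_cancel ?_⟩,
    w23, w26, w35, w56, hw25, w25.symm.trans hw25⟩
  · intro i hi
    fin_cases i <;> simp at hi <;> assumption
  · intro i hi
    fin_cases i <;> simp at hi
    exacts [⟨l2, f12, f42⟩, ⟨l3, f13, f43⟩, ⟨l5, f15, f45⟩, ⟨l6, f16, f46⟩]
  · linear_combination A23 + M 4 4 * hcu
  · linear_combination A56 - M 1 4 * hcu
  · linear_combination B23 - M 4 1 * hcu
  · linear_combination B56 + M 1 1 * hcu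

end Structure

/-! ### The character χ, the kernel T̃, and the stabilizer of w. -/

section Stab

variable {R : Type v} [CommRing R]

/-- The character `χ(g) = c(g₁)² det(g₂)³` of `G`, which is trivial on `T̃`. -/
def chi (g : Amb R) : R :=
  wCoord (g.1 : Matrix (Fin 7) (Fin 7) R) 1 2 3 ^ 2 * (g.2 : Matrix (Fin 2) (Fin 2) R).det ^ 3

variable (R) in
/-- The homomorphism `u ↦ (u I₇, u⁻¹ I₂)`. -/
def scalarPair : Rˣ →* Amb R :=
  (Units.map (algebraMap R (Matrix (Fin 7) (Fin 7) R)).toMonoidHom).prod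
    ((Units.map (algebraMap R (Matrix (Fin 2) (Fin 2) R)).toMonoidHom).comp (invMonoidHom))

theorem scalarPair_fst (u : Rˣ) : ((scalarPair R u).1 : Matrix (Fin 7) (Fin 7) R) =
    (u : R) • (1 : Matrix (Fin 7) (Fin 7) R) := by
  simp [scalarPair, Algebra.algebraMap_eq_smul_one]

theorem scalarPair_snd (u : Rˣ) : ((scalarPair R u).2 : Matrix (Fin 2) (Fin 2) R) =
    ((u⁻¹ : Rˣ) : R) • (1 : Matrix (Fin 2) (Fin 2) R) := by
  simp [scalarPair, Algebra.algebraMap_eq_smul_one]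

theorem d_fst (A : GL (Fin 2) R) : ((d A).1 : Matrix (Fin 7) (Fin 7) R) = d1Mat A := rfl

theorem d_snd (A : GL (Fin 2) R) : ((d A).2 : Matrix (Fin 2) (Fin 2) R) = d2Mat A := rfl

theorem d_mul_scalarPair_fst (A : GL (Fin 2) R) (u : Rˣ) :
    ((d A * scalarPair R u).1 : Matrix (Fin 7) (Fin 7) R) = (u : R) • d1Mat A := by
  rw [Prod.fst_mul, Units.val_mul, d_fst, scalarPair_fst, Matrix.mul_smul, mul_one]

theorem d_mul_scalarPair_snd (A : GL (Fin 2) R) (u : Rˣ) :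
    ((d A * scalarPair R u).2 : Matrix (Fin 2) (Fin 2) R) = ((u⁻¹ : Rˣ) : R) • d2Mat A := by
  rw [Prod.snd_mul, Units.val_mul, d_snd, scalarPair_snd, Matrix.mul_smul, mul_one]

theorem wPt_rep_iff (g : Amb R) : rep R g (wPt R) = wPt R ↔ ∀ i,
    g.1 i 1 * g.2 0 0 + g.1 i 4 * g.2 0 1 = (if i = 1 then 1 else 0) ∧
    g.1 i 1 * g.2 1 0 + g.1 i 4 * g.2 1 1 = (if i = 4 then 1 else 0) := by
  have h : ∀ i j, rep R g (wPt R) i j = g.1 i 1 * g.2 j 0 + g.1 i 4 * g.2 j 1 := by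
    intro i j
    simp [rep_apply, wPt, e, Matrix.mul_apply, Fin.sum_univ_two, Pi.single_apply]
  rw [← Matrix.ext_iff]
  refine forall_congr' fun i => ?_
  rw [Fin.forall_fin_two, h, h]
  simp [wPt, e, Pi.single_apply]

/-- Fixing w means that the 7×2 matrix of columns 1 and 4 of g_1, times ᵗg_2, is the pair (e_1, e_4)
in zero-based indices. Inverting g_2 gives the support of the columns; taking determinants of rows 1
and 4 gives the last relation. -/
theorem columns_of_stab_wPt {g : Amb R} (hw : rep R g (wPt R) = wPt R) :
    (∀ i, i ≠ 1 → i ≠ 4 → g.1 i 1 = 0) ∧ (∀ i, i ≠ 1 → i ≠ 4 → g.1 i 4 = 0) ∧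
    (g.1 1 1 * g.1 4 4 - g.1 1 4 * g.1 4 1) * (g.2 : Matrix (Fin 2) (Fin 2) R).det = 1 := by
  rw [wPt_rep_iff] at hw
  have hd : IsUnit (g.2 0 0 * g.2 1 1 - g.2 0 1 * g.2 1 0) := by
    have := (Matrix.isUnit_iff_isUnit_det _).mp g.2.isUnit
    rwa [Matrix.det_fin_two] at this
  refine ⟨fun i i1 i4 => ?_, fun i i1 i4 => ?_, ?_⟩
  · obtain ⟨x, y⟩ := hw i
    rw [if_neg i1] at x
    rw [if_neg i4] at y
    exact hd.mul_right_eq_zero.mp (by linear_combination g.2 1 1 * x - g.2 0 1 * y)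
  · obtain ⟨x, y⟩ := hw i
    rw [if_neg i1] at x
    rw [if_neg i4] at y
    exact hd.mul_right_eq_zero.mp (by linear_combination g.2 0 0 * y - g.2 1 0 * x)
  · obtain ⟨x, y⟩ := hw 1
    obtain ⟨z, t⟩ := hw 4
    simp only [if_true, show (1 : Fin 7) ≠ 4 by decide, show (4 : Fin 7) ≠ 1 by decide, if_false]
      at x y z t
    rw [Matrix.det_fin_two]
    linear_combination (g.1 4 1 * g.2 1 0 + g.1 4 4 * g.2 1 1) * x + t -
      (g.1 1 1 * g.2 1 0 + g.1 1 4 * g.2 1 1) * z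

/-- Only h has to scale w̄: g(h w̄) = c(h) g w̄, and one coordinate is then read off. -/
theorem wCoord_mul {g h : GL (Fin 7) R} (hh : h ∈ G1 R) :
    wCoord ((g * h : GL (Fin 7) R) : Matrix (Fin 7) (Fin 7) R) 1 2 3 =
    wCoord (g : Matrix (Fin 7) (Fin 7) R) 1 2 3 * wCoord (h : Matrix (Fin 7) (Fin 7) R) 1 2 3 := by
  obtain ⟨c, hc⟩ := hh
  have h1 := congrArg (coordForm R ![1, 2, 3]) hc
  rw [coordForm_map_wBar, map_smul, coordForm_wBar] at h1
  have h2 := coordForm_map_wBar ((g * h : GL (Fin 7) R) : Matrix (Fin 7) (Fin 7) R) ![1, 2, 3]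
  rw [Units.val_mul, Matrix.mulVecLin_mul, exteriorPower.map_comp, LinearMap.comp_apply, hc,
    map_smul, map_smul, coordForm_map_wBar] at h2
  simp only [Matrix.cons_val, wCoord_one_one_two_three, smul_eq_mul, mul_one] at h1 h2
  rw [h1, Units.val_mul, ← h2, mul_comm]

theorem chi_mul {g h : Amb R} (hh : h ∈ G R) : chi (g * h) = chi g * chi h := by
  simp only [chi]
  rw [Prod.fst_mul, wCoord_mul ((Amb.mem_G_iff h).mp hh), Prod.snd_mul, Units.val_mul,
    Matrix.det_mul]
  ring

theorem chi_map {S : Type w} [CommRing S] (f : R →+* S) (g : Amb R) :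
    chi (Amb.map f g) = f (chi g) := by
  simp only [chi, Amb.map_fst, Amb.map_snd, map_wCoord, map_mul, map_pow]
  rw [← RingHom.mapMatrix_apply, ← RingHom.map_det]

theorem scalarPair_mem_tildeT (u : Rˣ) : scalarPair R u ∈ tildeT R := by
  refine ⟨(Amb.mem_G_iff _).mpr ((mem_G1_iff _).mpr ⟨(u : R) ^ 3, fun i j l => ?_⟩),
    MonoidHom.mem_ker.mpr (LinearMap.ext fun x => ?_)⟩
  · rw [scalarPair_fst]
    simp only [wCoord, minorThree, Matrix.smul_apply, smul_eq_mul]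
    ring
  · rw [rep_apply, scalarPair_fst, scalarPair_snd]
    simp [smul_smul]

/-- Testing on matrix units turns triviality on V into g_1 ⊗ g_2 = 1 entrywise, which over any ring
forces both factors to be mutually inverse scalars. -/
theorem mem_tildeT_iff (g : Amb R) : g ∈ tildeT R ↔ ∃ u : Rˣ, g = scalarPair R u := by
  constructor
  · rintro ⟨-, hg⟩
    have h : ∀ i j a b, g.1 i a * g.2 j b = if i = a ∧ j = b then 1 else 0 := by
      intro i j a b
      have h1 := congrFun (congrFun (LinearMap.congr_fun (MonoidHom.mem_ker.mp hg)
        (Matrix.single a b (1 : R))) i) j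
      rw [rep_apply] at h1
      simpa [Matrix.mul_apply, Matrix.single, ite_and, eq_comm] using h1
    have h00 : g.1 0 0 * g.2 0 0 = 1 := by simpa using h 0 0 0 0
    have h00' : g.2 0 0 * g.1 0 0 = 1 := by rw [mul_comm, h00]
    refine ⟨⟨g.1 0 0, g.2 0 0, h00, h00'⟩, Amb.ext ?_ ?_⟩
    · rw [scalarPair_fst]
      ext i a
      have h1 := h i 0 a 0
      simp only [and_true] at h1
      rw [Matrix.smul_apply, Matrix.one_apply, ← h1, smul_eq_mul]
      linear_combination -(g.1 i a) * h00
    · rw [scalarPair_snd]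
      ext j b
      have h1 := h 0 j 0 b
      simp only [true_and] at h1
      rw [Matrix.smul_apply, Matrix.one_apply, ← h1, smul_eq_mul]
      change _ = g.2 0 0 * _
      linear_combination -(g.2 j b) * h00
  · rintro ⟨u, rfl⟩
    exact scalarPair_mem_tildeT u

/-- Cofactors replace ᵗA⁻¹, so that later matrix identities become polynomial in the entries of A
and x = (det A)⁻¹, modulo xy = 1. -/
theorem d1Mat_d2Mat_eq (A : GL (Fin 2) R) : ∃ x y : R, x * y = 1 ∧
    y = A 0 0 * A 1 1 - A 0 1 * A 1 0 ∧
    d1Mat A = !![1, 0, 0, 0, 0, 0, 0; 0, x, 0, 0, 0, 0, 0;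
      0, 0, A 0 0, A 0 1, 0, 0, 0; 0, 0, A 1 0, A 1 1, 0, 0, 0; 0, 0, 0, 0, y, 0, 0;
      0, 0, 0, 0, 0, x * A 1 1, -(x * A 1 0); 0, 0, 0, 0, 0, -(x * A 0 1), x * A 0 0] ∧
    d2Mat A = !![y, 0; 0, x] := by
  have hy : ((Matrix.GeneralLinearGroup.det A : Rˣ) : R) = A 0 0 * A 1 1 - A 0 1 * A 1 0 :=
    Matrix.det_fin_two _
  have hx : (((Matrix.GeneralLinearGroup.det A)⁻¹ : Rˣ) : R) *
      (Matrix.GeneralLinearGroup.det A : Rˣ) = 1 := Units.inv_mul _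
  have hinv : ((A⁻¹ : GL (Fin 2) R) : Matrix (Fin 2) (Fin 2) R) =
      (((Matrix.GeneralLinearGroup.det A)⁻¹ : Rˣ) : R) •
        !![A 1 1, -A 0 1; -A 1 0, A 0 0] := by
    rw [Units.inv_eq_of_mul_eq_one_right]
    rw [Matrix.mul_smul, ← Matrix.adjugate_fin_two, Matrix.mul_adjugate, smul_smul]
    exact (congrArg (· • (1 : Matrix (Fin 2) (Fin 2) R)) hx).trans (one_smul _ _)
  refine ⟨_, _, hx, hy, ?_, rfl⟩
  simp only [d1Mat, hinv]
  ext i j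
  fin_cases i <;> fin_cases j <;> simp

/-- With B = diag((det A)⁻¹, A), of determinant 1, d₁(A) is diag(1, B, ᵗB⁻¹): it fixes both volume
forms e_234, e_567 and the pairing e_25 + e_36 + e_47 (one-based), so the multiplier is 1. -/
theorem d_mem_G (A : GL (Fin 2) R) : d A ∈ G R := by
  refine (Amb.mem_G_iff _).mpr (mem_G1_of_lt (c := 1) fun i j l hij hjl => ?_)
  obtain ⟨x, y, hxy, hy, h1, -⟩ := d1Mat_d2Mat_eq A
  rw [d_fst, h1]
  clear h1
  generalize A 0 0 = a at *
  generalize A 0 1 = b at *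
  generalize A 1 0 = c at *
  generalize A 1 1 = d at *
  subst hy
  fin_cases i <;> fin_cases j <;> first | exact absurd hij (by decide) | skip
  all_goals fin_cases l <;> first | exact absurd hjl (by decide) | skip
  all_goals simp [wCoord, minorThree, Matrix.one_apply]
  all_goals first
    | ring1
    | linear_combination hxy
    | linear_combination -hxy
    | linear_combination x * (a * d - b * c) * hxy + hxy

theorem rep_d (A : GL (Fin 2) R) : rep R (d A) (wPt R) = wPt R := by
  rw [wPt_rep_iff]
  intro i
  obtain ⟨x, y, hxy, hy, h1, h2⟩ := d1Mat_d2Mat_eq A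
  rw [d_fst, d_snd, h1, h2]
  fin_cases i <;> simp [hxy, mul_comm y x]

theorem chi_d (A : GL (Fin 2) R) : chi (d A) = 1 := by
  obtain ⟨x, y, hxy, hy, h1, h2⟩ := d1Mat_d2Mat_eq A
  rw [chi, d_fst, d_snd, h1, h2]
  simp [wCoord, minorThree, ← hy, hxy, mul_comm y x]

theorem chi_scalarPair (u : Rˣ) : chi (scalarPair R u) = 1 := by
  have h := u.mul_inv
  simp only [chi, scalarPair_fst, scalarPair_snd]
  generalize ((u⁻¹ : Rˣ) : R) = x at *
  generalize (u : R) = y at *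
  simp [wCoord, minorThree]
  linear_combination (y^5*x^5+y^4*x^4+y^3*x^3+y^2*x^2+y*x+1)*h

/-- Writing m = ps − qr for the determinant of the block on e_2, e_5, one has c = um and m·det g_2 =
1, so χ = u² det g_2 = (ps + qr)/m. Thus χ = 1 means qr = 0, which together with sq = rp = 0 makes
the block diagonal. -/
theorem stab_wPt_structure (h2 : IsUnit (2 : R)) {g : Amb R} (hg : g ∈ G R)
    (hw : rep R g (wPt R) = wPt R) :
    chi g ^ 2 = 1 ∧ (chi g = 1 → ∃ (A : GL (Fin 2) R) (u : Rˣ), g = d A * scalarPair R u) := by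
  obtain ⟨h1, h4, hdet⟩ := columns_of_stab_wPt hw
  obtain ⟨hc, hE⟩ := isUnit_wCoord ((Amb.mem_G_iff g).mp hg)
  have hm := IsUnit.of_mul_eq_one _ hdet
  obtain ⟨hcol, hrow, ⟨sq, rp, hu2⟩, hcu, hu, ⟨A23, A25, A26, A35, A36, A56⟩,
    ⟨B23, B25, B26, B35, B36, B56⟩, w23, w26, w35, w56, w25, w36⟩ :=
    block_shape h2 hc hE h1 h4 hm
  rw [wPt_rep_iff] at hw
  have hchi : chi g = g.1 0 0 ^ 2 * (g.2 : Matrix (Fin 2) (Fin 2) R).det := by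
    rw [chi, hcu]
    linear_combination g.1 0 0 ^ 2 * (g.2 : Matrix (Fin 2) (Fin 2) R).det *
      ((g.1 1 1 * g.1 4 4 - g.1 1 4 * g.1 4 1) * (g.2 : Matrix (Fin 2) (Fin 2) R).det + 1) * hdet
  constructor
  · rw [hchi, hu2]
    linear_combination 4 * (g.2 : Matrix (Fin 2) (Fin 2) R).det ^ 2 * g.1 4 1 * g.1 1 1 * sq +
      ((g.1 1 1 * g.1 4 4 - g.1 1 4 * g.1 4 1) * (g.2 : Matrix (Fin 2) (Fin 2) R).det + 1) * hdet
  intro h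
  rw [hchi] at h
  have hum : g.1 0 0 ^ 2 = g.1 1 1 * g.1 4 4 - g.1 1 4 * g.1 4 1 := by
    linear_combination (g.1 1 1 * g.1 4 4 - g.1 1 4 * g.1 4 1) * h - g.1 0 0 ^ 2 * hdet
  have qr : g.1 1 4 * g.1 4 1 = 0 := h2.mul_right_eq_zero.mp (by linear_combination hum - hu2)
  have ps : g.1 1 1 * g.1 4 4 = g.1 0 0 ^ 2 := by linear_combination -hum + qr
  have hp : IsUnit (g.1 1 1) := isUnit_of_mul_isUnit_left (ps ▸ hu.pow 2)
  have hs : IsUnit (g.1 4 4) := isUnit_of_mul_isUnit_right (ps ▸ hu.pow 2)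
  have q0 : g.1 1 4 = 0 := hs.mul_right_eq_zero.mp sq
  have r0 : g.1 4 1 = 0 := hp.mul_left_eq_zero.mp rp
  clear hE hc h sq rp qr hchi
  have m23 : IsUnit (minorTwo (g.1 : Matrix (Fin 7) (Fin 7) R) 2 3 2 3) := A23 ▸ hu.mul hs
  have m56 : IsUnit (minorTwo (g.1 : Matrix (Fin 7) (Fin 7) R) 5 6 5 6) := B56 ▸ hu.mul hp
  -- In zero-based indices e_2 ∧ e_3 is now scaled by a unit, so columns 2 and 3 are supported on
  -- rows 2 and 3; the same argument applies to e_5 ∧ e_6.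
  have n52 : g.1 5 2 = 0 := m23.mul_left_eq_zero.mp (by
    simp only [minorTwo] at A25 A35 ⊢
    linear_combination g.1 3 2 * A25 - g.1 2 2 * A35)
  have n53 : g.1 5 3 = 0 := m23.mul_left_eq_zero.mp (by
    simp only [minorTwo] at A25 A35 ⊢
    linear_combination g.1 3 3 * A25 - g.1 2 3 * A35)
  have n62 : g.1 6 2 = 0 := m23.mul_left_eq_zero.mp (by
    simp only [minorTwo] at A26 A36 ⊢
    linear_combination g.1 3 2 * A26 - g.1 2 2 * A36)
  have n63 : g.1 6 3 = 0 := m23.mul_left_eq_zero.mp (by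
    simp only [minorTwo] at A26 A36 ⊢
    linear_combination g.1 3 3 * A26 - g.1 2 3 * A36)
  have n25 : g.1 2 5 = 0 := m56.mul_left_eq_zero.mp (by
    simp only [minorTwo] at B25 B26 ⊢
    linear_combination g.1 5 5 * B26 - g.1 6 5 * B25)
  have n26 : g.1 2 6 = 0 := m56.mul_left_eq_zero.mp (by
    simp only [minorTwo] at B25 B26 ⊢
    linear_combination g.1 5 6 * B26 - g.1 6 6 * B25)
  have n35 : g.1 3 5 = 0 := m56.mul_left_eq_zero.mp (by
    simp only [minorTwo] at B35 B36 ⊢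
    linear_combination g.1 5 5 * B36 - g.1 6 5 * B35)
  have n36 : g.1 3 6 = 0 := m56.mul_left_eq_zero.mp (by
    simp only [minorTwo] at B35 B36 ⊢
    linear_combination g.1 5 6 * B36 - g.1 6 6 * B35)
  simp only [minorTwo, symCoord] at A23 w23 w26 w35 w56 w25 w36
  obtain ⟨u, hu00⟩ := hu
  have huv : (u : R) * ((u⁻¹ : Rˣ) : R) = 1 := u.mul_inv
  have hdetA : (((u⁻¹ : Rˣ) : R) • !![g.1 2 2, g.1 2 3; g.1 3 2, g.1 3 3] :
      Matrix (Fin 2) (Fin 2) R).det = ((u⁻¹ : Rˣ) : R) * g.1 4 4 := by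
    rw [Matrix.det_fin_two]
    simp only [Matrix.smul_apply, smul_eq_mul, Matrix.of_apply, Matrix.cons_val]
    rw [← hu00] at A23
    linear_combination ((u⁻¹ : Rˣ) : R) ^ 2 * A23 + ((u⁻¹ : Rˣ) : R) * g.1 4 4 * huv
  -- The factor u⁻¹ removes the scalar part, which is visible in the (0, 0) entry because d₁ has a 1
  -- there.
  let A : GL (Fin 2) R := Matrix.GeneralLinearGroup.mk''
    (((u⁻¹ : Rˣ) : R) • !![g.1 2 2, g.1 2 3; g.1 3 2, g.1 3 3])
    (hdetA ▸ (u⁻¹).isUnit.mul hs)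
  have hA : (A : Matrix (Fin 2) (Fin 2) R) =
    ((u⁻¹ : Rˣ) : R) • !![g.1 2 2, g.1 2 3; g.1 3 2, g.1 3 3] := rfl
  refine ⟨A, u, ?_⟩
  obtain ⟨x, y, hxy, hy, e1, e2⟩ := d1Mat_d2Mat_eq A
  rw [← Matrix.det_fin_two, hA, hdetA] at hy
  have a00 : A 0 0 = ((u⁻¹ : Rˣ) : R) * g.1 2 2 := by rw [hA]; simp
  have a01 : A 0 1 = ((u⁻¹ : Rˣ) : R) * g.1 2 3 := by rw [hA]; simp
  have a10 : A 1 0 = ((u⁻¹ : Rˣ) : R) * g.1 3 2 := by rw [hA]; simp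
  have a11 : A 1 1 = ((u⁻¹ : Rˣ) : R) * g.1 3 3 := by rw [hA]; simp
  rw [a00, a01, a10, a11] at e1
  clear_value A
  clear a00 a01 a10 a11 hA hdetA
  rw [q0, zero_mul, sub_zero, ps] at w25 w36
  rw [← hu00] at w25 w36 ps A23
  simp only [n52, n53, n62, n63, zero_mul, sub_zero] at w25 w26 w35 w36
  have e3 := d_mul_scalarPair_snd A u
  generalize ((u⁻¹ : Rˣ) : R) = t at *
  have hus : IsUnit ((u : R) * g.1 4 4) := u.isUnit.mul hs
  have hxs : x * g.1 4 4 = u := by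
    rw [hy] at hxy
    linear_combination (u : R) * hxy - x * g.1 4 4 * huv
  refine Amb.ext ?_ ?_
  · have x11 : g.1 1 1 = u * x := hs.mul_right_cancel (by
      linear_combination ps - u * hxs)
    have x44 : g.1 4 4 = u * y := by rw [hy]; linear_combination -(g.1 4 4) * huv
    -- The lower 2×2 block is forced to be u·ᵗA⁻¹ because ω is preserved up to a scalar.
    have x55 : g.1 5 5 = u * (x * (t * g.1 3 3)) := hus.mul_left_cancel (by
      linear_combination g.1 3 3 * w25 - g.1 2 3 * w35 - g.1 5 5 * A23
        - u * u * t * g.1 3 3 * hxs - u * u * g.1 3 3 * huv)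
    have x56 : g.1 5 6 = u * (-(x * (t * g.1 3 2))) := hus.mul_left_cancel (by
      linear_combination g.1 2 2 * w35 - g.1 3 2 * w25 - g.1 5 6 * A23
        + u * u * t * g.1 3 2 * hxs + u * u * g.1 3 2 * huv)
    have x65 : g.1 6 5 = u * (-(x * (t * g.1 2 3))) := hus.mul_left_cancel (by
      linear_combination g.1 3 3 * w26 - g.1 2 3 * w36 - g.1 6 5 * A23
        + u * u * t * g.1 2 3 * hxs + u * u * g.1 2 3 * huv)
    have x66 : g.1 6 6 = u * (x * (t * g.1 2 2)) := hus.mul_left_cancel (by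
      linear_combination g.1 2 2 * w36 - g.1 3 2 * w26 - g.1 6 6 * A23
        - u * u * t * g.1 2 2 * hxs - u * u * g.1 2 2 * huv)
    rw [mul_neg] at x56 x65
    have scale : ∀ z : R, z = u * (t * z) := fun z => by linear_combination -z * huv
    have r2 := hrow 2 (by decide)
    have r3 := hrow 3 (by decide)
    have r5 := hrow 5 (by decide)
    have r6 := hrow 6 (by decide)
    rw [d_mul_scalarPair_fst, e1]
    ext i j
    fin_cases j
    · by_cases hi : i = 0
      · subst hi
        simpa using hu00.symm
      · refine (hcol i hi).trans ?_
        fin_cases i <;> simp at hi ⊢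
    · by_cases hi : i = 1
      · subst hi
        simpa using x11
      · by_cases hi' : i = 4
        · subst hi'
          simpa using r0
        · refine (h1 i hi hi').trans ?_
          fin_cases i <;> simp at hi hi' ⊢
    · fin_cases i <;> simp [r2, n52, n62, ← scale]
    · fin_cases i <;> simp [r3, n53, n63, ← scale]
    · by_cases hi : i = 4
      · subst hi
        simpa using x44
      · by_cases hi' : i = 1
        · subst hi'
          simpa using q0
        · refine (h4 i hi' hi).trans ?_
          fin_cases i <;> simp at hi hi' ⊢
    · fin_cases i <;> simp [r5, n25, n35] <;> assumption
    · fin_cases i <;> simp [r6, n26, n36] <;> assumption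
  · obtain ⟨k1, k2⟩ := hw 1
    obtain ⟨k3, k4⟩ := hw 4
    simp [q0, r0] at k1 k2 k3 k4
    rw [e3, e2]
    ext i j
    fin_cases i <;> fin_cases j <;> simp
    · refine hp.mul_left_cancel ?_
      linear_combination k1 - t * t * ps - (u * t + 1) * huv - g.1 1 1 * t * hy
    · exact hs.mul_right_eq_zero.mp k3
    · exact hp.mul_right_eq_zero.mp k2
    · refine hs.mul_left_cancel ?_
      linear_combination k4 - t * hxs - huv

end Stab

/-! ### The involution θ, the swap, and the unitary equation as a twisted fixed-point condition. -/

section Theta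

variable {R : Type v} [CommRing R]

theorem d_mul_scalarPair_injective {A B : GL (Fin 2) R} {u v : Rˣ}
    (h : d A * scalarPair R u = d B * scalarPair R v) : A = B ∧ u = v := by
  have h1 := d_mul_scalarPair_fst A u
  rw [h, d_mul_scalarPair_fst] at h1
  have huv : v = u := by
    refine Units.ext ?_
    simpa [d1Mat] using congrFun (congrFun h1 0) 0
  subst huv
  refine ⟨Units.ext ?_, rfl⟩
  have key : ∀ i j, d1Mat B i j = d1Mat A i j := fun i j =>
    v.isUnit.mul_left_cancel (congrFun (congrFun h1 i) j)
  ext i j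
  fin_cases i <;> fin_cases j
  · exact (key 2 2).symm
  · exact (key 2 3).symm
  · exact (key 3 2).symm
  · exact (key 3 3).symm

theorem scalarPair_mul_comm (u : Rˣ) (g : Amb R) : scalarPair R u * g = g * scalarPair R u := by
  refine Amb.ext ?_ ?_
  · rw [Prod.fst_mul, Prod.fst_mul, Units.val_mul, Units.val_mul, scalarPair_fst]
    simp
  · rw [Prod.snd_mul, Prod.snd_mul, Units.val_mul, Units.val_mul, scalarPair_snd]
    simp

theorem Amb.map_scalarPair {S : Type w} [CommRing S] (f : R →+* S) (u : Rˣ) :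
    Amb.map f (scalarPair R u) = scalarPair S (Units.map f u) := by
  refine Amb.ext ?_ ?_
  · rw [Amb.map_fst, scalarPair_fst, scalarPair_fst]
    ext i j
    simp [Matrix.one_apply, apply_ite f]
  · rw [Amb.map_snd, scalarPair_snd, scalarPair_snd, ← map_inv]
    ext i j
    simp only [Matrix.map_apply, Matrix.smul_apply, Matrix.one_apply, smul_eq_mul, mul_ite,
      mul_one, mul_zero, apply_ite f, map_zero]
    rfl

theorem Amb.map_d {S : Type w} [CommRing S] (f : R →+* S) (A : GL (Fin 2) R) :
    Amb.map f (d A) = d (Matrix.GeneralLinearGroup.map f A) := by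
  have hdet : Matrix.GeneralLinearGroup.det (Matrix.GeneralLinearGroup.map f A) =
      Units.map f (Matrix.GeneralLinearGroup.det A) := by
    refine Units.ext ?_
    change ((A : Matrix (Fin 2) (Fin 2) R).map f).det = f (A : Matrix (Fin 2) (Fin 2) R).det
    rw [← RingHom.mapMatrix_apply, ← RingHom.map_det]
  have hinv : (Matrix.GeneralLinearGroup.map f A)⁻¹ = Matrix.GeneralLinearGroup.map f A⁻¹ :=
    (map_inv _ _).symm
  refine Amb.ext ?_ ?_
  · rw [Amb.map_fst, d_fst, d_fst]
    simp only [d1Mat, hdet, hinv, ← map_inv]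
    ext i j
    fin_cases i <;> fin_cases j <;> simp only [Matrix.map_apply] <;> first
      | exact map_zero f
      | exact map_one f
      | rfl
  · rw [Amb.map_snd, d_snd, d_snd]
    simp only [d2Mat, hdet, ← map_inv]
    ext i j
    fin_cases i <;> fin_cases j <;> simp only [Matrix.map_apply] <;> first
      | exact map_zero f
      | rfl

theorem Lam_mul_Lam : Lam R * Lam R = 1 := by
  ext i j
  fin_cases i <;> fin_cases j <;> simp [Lam]

/-- The automorphism `A ↦ Λ ᵗA⁻¹ Λ` of `GL(2)`. -/
def theta (A : GL (Fin 2) R) : GL (Fin 2) R where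
  val := Lam R * ((A⁻¹ : GL (Fin 2) R) : Matrix (Fin 2) (Fin 2) R)ᵀ * Lam R
  inv := Lam R * (A : Matrix (Fin 2) (Fin 2) R)ᵀ * Lam R
  val_inv := by
    rw [show Lam R * ((A⁻¹ : GL (Fin 2) R) : Matrix (Fin 2) (Fin 2) R)ᵀ * Lam R *
        (Lam R * (A : Matrix (Fin 2) (Fin 2) R)ᵀ * Lam R) = Lam R *
          (((A⁻¹ : GL (Fin 2) R) : Matrix (Fin 2) (Fin 2) R)ᵀ * (Lam R * Lam R) *
            (A : Matrix (Fin 2) (Fin 2) R)ᵀ) * Lam R by simp only [Matrix.mul_assoc],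
      Lam_mul_Lam, mul_one, ← Matrix.transpose_mul, Units.mul_inv, Matrix.transpose_one, mul_one,
      Lam_mul_Lam]
  inv_val := by
    rw [show Lam R * (A : Matrix (Fin 2) (Fin 2) R)ᵀ * Lam R *
        (Lam R * ((A⁻¹ : GL (Fin 2) R) : Matrix (Fin 2) (Fin 2) R)ᵀ * Lam R) = Lam R *
          ((A : Matrix (Fin 2) (Fin 2) R)ᵀ * (Lam R * Lam R) *
            ((A⁻¹ : GL (Fin 2) R) : Matrix (Fin 2) (Fin 2) R)ᵀ) * Lam R by
        simp only [Matrix.mul_assoc],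
      Lam_mul_Lam, mul_one, ← Matrix.transpose_mul, Units.inv_mul, Matrix.transpose_one, mul_one,
      Lam_mul_Lam]

/-- Solving A Λ ᵗ(A^s) = Λ for A^s, with Λ² = 1, puts the unitary condition in the form that descent
produces. -/
theorem mem_unitaryOf_iff (s : R →+* R) (A : GL (Fin 2) R) :
    A ∈ unitaryOf s ↔ Matrix.GeneralLinearGroup.map s A = theta A := by
  have hinv : ((A⁻¹ : GL (Fin 2) R) : Matrix (Fin 2) (Fin 2) R) * A = 1 := A.inv_mul
  have hinv' : (A : Matrix (Fin 2) (Fin 2) R) * (A⁻¹ : GL (Fin 2) R) = 1 := A.mul_inv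
  constructor
  · intro h
    have h : (A : Matrix (Fin 2) (Fin 2) R) * Lam R *
      ((A : Matrix (Fin 2) (Fin 2) R).map s)ᵀ = Lam R := h
    have h1 : ((A : Matrix (Fin 2) (Fin 2) R).map s)ᵀ =
        Lam R * ((A⁻¹ : GL (Fin 2) R) : Matrix (Fin 2) (Fin 2) R) * Lam R := by
      calc _ = Lam R * (((A⁻¹ : GL (Fin 2) R) : Matrix (Fin 2) (Fin 2) R) * A) * Lam R *
            ((A : Matrix (Fin 2) (Fin 2) R).map s)ᵀ := by rw [hinv, mul_one, Lam_mul_Lam, one_mul]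
        _ = Lam R * ((A⁻¹ : GL (Fin 2) R) : Matrix (Fin 2) (Fin 2) R) * (A * Lam R *
            ((A : Matrix (Fin 2) (Fin 2) R).map s)ᵀ) := by simp only [Matrix.mul_assoc]
        _ = _ := by rw [h]
    refine Units.ext (Matrix.transpose_injective (h1.trans ?_))
    change _ = (Lam R * ((A⁻¹ : GL (Fin 2) R) : Matrix (Fin 2) (Fin 2) R)ᵀ * Lam R)ᵀ
    have hL : (Lam R)ᵀ = Lam R := by
      ext i j
      fin_cases i <;> fin_cases j <;> simp [Lam]
    rw [Matrix.transpose_mul, Matrix.transpose_mul, hL, Matrix.transpose_transpose,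
      Matrix.mul_assoc]
  · intro h
    have h1 : (A : Matrix (Fin 2) (Fin 2) R).map s =
        Lam R * ((A⁻¹ : GL (Fin 2) R) : Matrix (Fin 2) (Fin 2) R)ᵀ * Lam R :=
      congrArg (fun B : GL (Fin 2) R => (B : Matrix (Fin 2) (Fin 2) R)) h
    change (A : Matrix (Fin 2) (Fin 2) R) * Lam R * ((A : Matrix (Fin 2) (Fin 2) R).map s)ᵀ = Lam R
    have hL : (Lam R)ᵀ = Lam R := by
      ext i j
      fin_cases i <;> fin_cases j <;> simp [Lam]
    rw [h1, Matrix.transpose_mul, Matrix.transpose_mul, hL, Matrix.transpose_transpose]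
    calc _ = (A : Matrix (Fin 2) (Fin 2) R) * (Lam R * Lam R) *
          ((A⁻¹ : GL (Fin 2) R) : Matrix (Fin 2) (Fin 2) R) * Lam R := by
          simp only [Matrix.mul_assoc]
      _ = _ := by rw [Lam_mul_Lam, mul_one, hinv', one_mul]

variable (R) in
/-- The matrix of the involution of `W` exchanging `e₂, e₃, e₄` with `e₅, e₆, -e₇`. -/
def swapMat : Matrix (Fin 7) (Fin 7) R :=
  !![1, 0, 0, 0, 0, 0, 0;
     0, 0, 0, 0, 1, 0, 0;
     0, 0, 0, 0, 0, 1, 0;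
     0, 0, 0, 0, 0, 0, -1;
     0, 1, 0, 0, 0, 0, 0;
     0, 0, 1, 0, 0, 0, 0;
     0, 0, 0, -1, 0, 0, 0]

theorem swapMat_mul_swapMat : swapMat R * swapMat R = 1 := by
  ext i j
  fin_cases i <;> fin_cases j <;> simp [swapMat, Matrix.mul_apply, Fin.sum_univ_succ]

theorem flip_mul_flip : (!![0, 1; 1, 0] * !![0, 1; 1, 0] : Matrix (Fin 2) (Fin 2) R) = 1 := by
  ext i j
  fin_cases i <;> fin_cases j <;> simp

variable (R) in
/-- The element of the stabilizer of `w` outside its identity component. -/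
def swapPair : Amb R :=
  (⟨swapMat R, swapMat R, swapMat_mul_swapMat, swapMat_mul_swapMat⟩,
    ⟨!![0, 1; 1, 0], !![0, 1; 1, 0], flip_mul_flip, flip_mul_flip⟩)

theorem Amb.map_swapPair {S : Type w} [CommRing S] (f : R →+* S) :
    Amb.map f (swapPair R) = swapPair S := by
  refine Amb.ext ?_ ?_
  · change (swapMat R).map f = swapMat S
    ext i j
    fin_cases i <;> fin_cases j <;> simp [swapMat]
  · change (!![0, 1; 1, 0] : Matrix (Fin 2) (Fin 2) R).map f = !![0, 1; 1, 0]
    ext i j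
    fin_cases i <;> fin_cases j <;> simp

theorem Lam_mul_transpose_mul_Lam (B : Matrix (Fin 2) (Fin 2) R) :
    Lam R * Bᵀ * Lam R = !![B 0 0, -B 1 0; -B 0 1, B 1 1] := by
  ext i j
  fin_cases i <;> fin_cases j <;>
    simp [Lam, Matrix.mul_apply, Fin.sum_univ_two, Matrix.vecMul, dotProduct]

/-- Exchanging the blocks B and ᵗB⁻¹ of d₁ replaces A by ᵗA⁻¹; the sign in e_4 ↔ −e_7 (one-based)
contributes the conjugation by Λ. -/
theorem d_mul_swapPair (A : GL (Fin 2) R) : d A * swapPair R = swapPair R * d (theta A) := by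
  obtain ⟨x, y, hxy, hy, e1, e2⟩ := d1Mat_d2Mat_eq A
  obtain ⟨x', y', hxy', hy', e1', e2'⟩ := d1Mat_d2Mat_eq (theta A)
  have b00 : A⁻¹ 0 0 = x * A 1 1 := congrFun (congrFun e1 5) 5
  have b10 : A⁻¹ 1 0 = -(x * A 1 0) := congrFun (congrFun e1 5) 6
  have b01 : A⁻¹ 0 1 = -(x * A 0 1) := congrFun (congrFun e1 6) 5
  have b11 : A⁻¹ 1 1 = x * A 0 0 := congrFun (congrFun e1 6) 6
  have hθ : (theta A : Matrix (Fin 2) (Fin 2) R) =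
      !![A⁻¹ 0 0, -A⁻¹ 1 0; -A⁻¹ 0 1, A⁻¹ 1 1] := Lam_mul_transpose_mul_Lam _
  rw [b00, b01, b10, b11, neg_neg, neg_neg] at hθ
  have t00 : theta A 0 0 = x * A 1 1 := by rw [hθ]; rfl
  have t01 : theta A 0 1 = x * A 1 0 := by rw [hθ]; rfl
  have t10 : theta A 1 0 = x * A 0 1 := by rw [hθ]; rfl
  have t11 : theta A 1 1 = x * A 0 0 := by rw [hθ]; rfl
  have hyx : y' = x := by
    rw [hy', t00, t01, t10, t11]
    linear_combination x * hxy - x * x * hy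
  have hxy2 : x' = y := by
    rw [hyx] at hxy'
    linear_combination y * hxy' - x' * hxy
  rw [t00, t01, t10, t11, hyx, hxy2] at e1'
  rw [hyx, hxy2] at e2'
  have c : ∀ z, y * (x * z) = z := fun z => by linear_combination z * hxy
  refine Amb.ext ?_ ?_
  · rw [Prod.fst_mul, Prod.fst_mul, Units.val_mul, Units.val_mul, d_fst, d_fst, e1, e1']
    change _ * swapMat R = swapMat R * _
    ext i j
    fin_cases i <;> fin_cases j <;>
      simp [swapMat, Matrix.mul_apply, Fin.sum_univ_succ, c]
  · rw [Prod.snd_mul, Prod.snd_mul, Units.val_mul, Units.val_mul, d_snd, d_snd, e2, e2']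
    change _ * !![0, 1; 1, 0] = !![0, 1; 1, 0] * _
    ext i j
    fin_cases i <;> fin_cases j <;> simp

end Theta

/-! ### The element g_α and the point w_α. -/

section GAlphaPoint

variable {K : Type w} [Field K] [CharZero K]

theorem hZero_mem_G1 : hZero K ∈ G1 K := by
  refine mem_G1_of_lt (c := 1) fun i j l hij hjl => ?_
  change wCoord (hZeroMat K) i j l = _
  fin_cases i <;> fin_cases j <;> first | exact absurd hij (by decide) | skip
  all_goals fin_cases l <;> first | exact absurd hjl (by decide) | skip
  all_goals simp [wCoord, minorThree, hZeroMat, Matrix.one_apply]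
  all_goals norm_num

/-- Each of the five terms of w̄ has weight 1 under the diagonal factor, so only the scalar α
contributes, with multiplier α³. -/
theorem gAlpha1_mem_G1 (α : K) (hα : α ≠ 0) : gAlpha1 α hα ∈ G1 K := by
  refine Subgroup.mul_mem _ (mem_G1_of_lt (c := α ^ 3) fun i j l hij hjl => ?_) hZero_mem_G1
  change wCoord (α • Matrix.diagonal ![1, α, 1, α⁻¹, α⁻¹, 1, α]) i j l = _
  fin_cases i <;> fin_cases j <;> first | exact absurd hij (by decide) | skip
  all_goals fin_cases l <;> first | exact absurd hjl (by decide) | skip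
  all_goals simp [wCoord, minorThree, Matrix.one_apply]
  all_goals field_simp

theorem gAlpha1_val (α : K) (hα : α ≠ 0) : (gAlpha1 α hα : Matrix (Fin 7) (Fin 7) K) =
    α • Matrix.diagonal ![1, α, 1, α⁻¹, α⁻¹, 1, α] * hZeroMat K := rfl

theorem gAlpha2_val (α : K) (hα : α ≠ 0) : (gAlpha2 α hα : Matrix (Fin 2) (Fin 2) K) =
    !![1, 1; α, -α] := rfl

theorem gAlpha_mem_G (α : K) (hα : α ≠ 0) : gAlpha α hα ∈ G K :=
  (Amb.mem_G_iff _).mpr (gAlpha1_mem_G1 α hα)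

/-- The point `w_α`, where `a = α²`. -/
def wAlpha {k : Type u} [CommRing k] (a : k) : V k :=
  !![0, -2 * a; a, 0; 0, 0; 0, 0; 1, 0; 0, 0; 0, 0]

/-- The images of e_2 and e_5 (one-based) under g_{α,1} differ by α ↦ −α, and g_{α,2} forms their
sum and α times their difference; hence only α² survives. -/
theorem wAlpha_map {k : Type u} [Field k] [Algebra k K] (α : K) (hα : α ≠ 0) {a : k}
    (ha : algebraMap k K a = α ^ 2) :
    (wAlpha a).map (algebraMap k K) = rep K (gAlpha α hα) (wPt K) := by
  rw [rep_apply]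
  change _ = (gAlpha1 α hα : Matrix (Fin 7) (Fin 7) K) * _ *
    (gAlpha2 α hα : Matrix (Fin 2) (Fin 2) K).transpose
  rw [gAlpha1_val, gAlpha2_val]
  ext i j
  fin_cases i <;> fin_cases j <;>
    simp [wAlpha, wPt, e, hZeroMat, Matrix.mul_apply, Fin.sum_univ_succ, Matrix.diagonal_apply, ha,
      map_ofNat (algebraMap k K) 2,
      Pi.single_apply]
  all_goals field_simp
  all_goals ring

/-- This is the cocycle σ ↦ g_α⁻¹ σ(g_α): its value is the swap, the source of the twist from GL(2)
to the unitary group. -/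
theorem gAlpha_map (α : K) (hα : α ≠ 0) (σ : K →+* K)
    (hσ : σ α = -α) : Amb.map σ (gAlpha α hα) = gAlpha α hα * swapPair K := by
  have hσ2 : σ 2 = 2 := map_ofNat σ 2
  refine Amb.ext ?_ ?_
  · change (gAlpha1 α hα : Matrix (Fin 7) (Fin 7) K).map σ =
      (gAlpha1 α hα : Matrix (Fin 7) (Fin 7) K) * swapMat K
    rw [gAlpha1_val]
    ext i j
    fin_cases i <;> fin_cases j <;>
      simp [hZeroMat, Matrix.mul_apply, Fin.sum_univ_succ, Matrix.diagonal_apply, hσ, hσ2, swapMat]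
    all_goals ring
  · change (gAlpha2 α hα : Matrix (Fin 2) (Fin 2) K).map σ =
      (gAlpha2 α hα : Matrix (Fin 2) (Fin 2) K) * !![0, 1; 1, 0]
    rw [gAlpha2_val]
    ext i j
    fin_cases i <;> fin_cases j <;> simp [hσ]

end GAlphaPoint

/-! ### Galois descent from R(α) to R. -/

section Descent

variable {k : Type u} [Field k] {K : Type w} [Field K] [Algebra k K]

theorem exists_add_mul_of_adjoin_eq_top {α : K} (hα2 : α ^ 2 ∈ Set.range (algebraMap k K))
    (hK : IntermediateField.adjoin k {α} = ⊤) (z : K) :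
    ∃ a b : k, z = algebraMap k K a + algebraMap k K b * α := by
  obtain ⟨c, hc⟩ := hα2
  have hint : IsIntegral k α :=
    IsIntegral.of_pow (n := 2) (by norm_num) (hc ▸ isIntegral_algebraMap)
  have hz : z ∈ Algebra.adjoin k {α} := by
    rw [← IntermediateField.adjoin_simple_toSubalgebra_of_isAlgebraic hint.isAlgebraic, hK]
    trivial
  induction hz using Algebra.adjoin_induction with
  | mem x hx => exact ⟨0, 1, by rw [Set.mem_singleton_iff.mp hx]; simp⟩
  | algebraMap r => exact ⟨r, 0, by simp⟩
  | add x y _ _ hx hy =>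
    obtain ⟨a, b, rfl⟩ := hx
    obtain ⟨a', b', rfl⟩ := hy
    exact ⟨a + a', b + b', by simp only [map_add]; ring⟩
  | mul x y _ _ hx hy =>
    obtain ⟨a, b, rfl⟩ := hx
    obtain ⟨a', b', rfl⟩ := hy
    refine ⟨a * a' + b * b' * c, a * b' + b * a', ?_⟩
    simp only [map_add, map_mul, hc]
    ring

theorem apply_eq_neg_of_ne_one {α : K} (hα2 : α ^ 2 ∈ Set.range (algebraMap k K))
    (hK : IntermediateField.adjoin k {α} = ⊤) {σ : K ≃ₐ[k] K} (hσ : σ ≠ 1) : σ α = -α := by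
  have hsq : σ α ^ 2 = α ^ 2 := by
    obtain ⟨c, hc⟩ := hα2
    rw [← map_pow, ← hc, σ.commutes]
  refine (sq_eq_sq_iff_eq_or_eq_neg.mp hsq).resolve_left fun h => hσ ?_
  ext z
  obtain ⟨a, b, rfl⟩ := exists_add_mul_of_adjoin_eq_top hα2 hK z
  simp [h]

variable {R : Type v} [CommRing R] [Algebra k R]

theorem includeLeft_injective :
    Function.Injective (Algebra.TensorProduct.includeLeft : R →ₐ[k] (R ⊗[k] K)).toRingHom :=
  Algebra.TensorProduct.includeLeft_injective (S := k) (A := R) (B := K)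
    (algebraMap k K).injective

theorem toExt_injective : Function.Injective (toExt k K R) :=
  Amb.map_injective includeLeft_injective

/-- Every element is r ⊗ 1 + s ⊗ α, and invariance under α ↦ −α gives 2(s ⊗ α) = 0. -/
theorem exists_includeLeft_eq [CharZero k] {α : K} (hα2 : α ^ 2 ∈ Set.range (algebraMap k K))
    (hK : IntermediateField.adjoin k {α} = ⊤) {σ : K ≃ₐ[k] K} (hσ : σ ≠ 1) {x : R ⊗[k] K}
    (hx : conj σ R x = x) : ∃ r : R, r ⊗ₜ[k] (1 : K) = x := by
  have hx' : ∃ r s : R, x = r ⊗ₜ[k] (1 : K) + s ⊗ₜ[k] α := by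
    clear hx
    induction x with
    | zero => exact ⟨0, 0, by simp⟩
    | tmul r z =>
      obtain ⟨a, b, rfl⟩ := exists_add_mul_of_adjoin_eq_top hα2 hK z
      refine ⟨a • r, b • r, ?_⟩
      rw [TensorProduct.tmul_add, TensorProduct.smul_tmul, TensorProduct.smul_tmul,
        Algebra.algebraMap_eq_smul_one, ← Algebra.smul_def]
    | add x y hx hy =>
      obtain ⟨r, s, rfl⟩ := hx
      obtain ⟨r', s', rfl⟩ := hy
      exact ⟨r + r', s + s', by simp only [TensorProduct.add_tmul]; abel⟩
  obtain ⟨r, s, rfl⟩ := hx'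
  refine ⟨r, ?_⟩
  have h1 : conj σ R (r ⊗ₜ[k] (1 : K) + s ⊗ₜ[k] α) = r ⊗ₜ[k] (1 : K) - s ⊗ₜ[k] α := by
    simp [conj, apply_eq_neg_of_ne_one hα2 hK hσ, TensorProduct.tmul_neg, sub_eq_add_neg]
  rw [h1] at hx
  have h2 : (2 : k) • (s ⊗ₜ[k] α) = 0 := by
    rw [two_smul]
    linear_combination (exp := 1) -hx
  rw [(smul_eq_zero_iff_right (two_ne_zero)).mp h2, add_zero]

theorem conj_includeLeft (σ : K ≃ₐ[k] K) :
    (conj σ R).comp (Algebra.TensorProduct.includeLeft : R →ₐ[k] (R ⊗[k] K)).toRingHom =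
      (Algebra.TensorProduct.includeLeft : R →ₐ[k] (R ⊗[k] K)).toRingHom := by
  ext r
  simp [conj]

theorem conj_includeRight (σ : K ≃ₐ[k] K) :
    (conj σ R).comp (Algebra.TensorProduct.includeRight : K →ₐ[k] (R ⊗[k] K)).toRingHom =
      (Algebra.TensorProduct.includeRight : K →ₐ[k] (R ⊗[k] K)).toRingHom.comp
        (σ : K →+* K) := by
  ext z
  simp [conj]

theorem Amb.map_map {R S T : Type*} [CommRing R] [CommRing S] [CommRing T] (f : R →+* S)
    (f' : S →+* T) (g : Amb R) : Amb.map f' (Amb.map f g) = Amb.map (f'.comp f) g := rfl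

theorem exists_toExt_eq [CharZero k] {α : K} (hα2 : α ^ 2 ∈ Set.range (algebraMap k K))
    (hK : IntermediateField.adjoin k {α} = ⊤) {σ : K ≃ₐ[k] K} (hσ : σ ≠ 1) {g : Amb (R ⊗[k] K)}
    (hg : Amb.map (conj σ R) g = g) : ∃ g₀ : Amb R, toExt k K R g₀ = g := by
  have hmat : ∀ (n : ℕ) (M : Matrix (Fin n) (Fin n) (R ⊗[k] K)), M.map (conj σ R) = M →
      ∃ M₀ : Matrix (Fin n) (Fin n) R,
        M₀.map (Algebra.TensorProduct.includeLeft : R →ₐ[k] (R ⊗[k] K)).toRingHom = M := by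
    intro n M hM
    choose r hr using fun i j =>
      exists_includeLeft_eq hα2 hK hσ (congrFun (congrFun hM i) j)
    exact ⟨Matrix.of r, Matrix.ext hr⟩
  have hunit : ∀ (n : ℕ) (M : GL (Fin n) (R ⊗[k] K)),
      Matrix.GeneralLinearGroup.map (conj σ R) M = M → ∃ M₀ : GL (Fin n) R,
        Matrix.GeneralLinearGroup.map
          (Algebra.TensorProduct.includeLeft : R →ₐ[k] (R ⊗[k] K)).toRingHom M₀ = M := by
    intro n M hM
    obtain ⟨M₀, h₀⟩ := hmat n M (congrArg Units.val hM)
    -- The inverse is invariant too, so it also descends; the relation between the two descends by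
    -- injectivity.
    have hM' : Matrix.GeneralLinearGroup.map (conj σ R) M⁻¹ = M⁻¹ := by rw [map_inv, hM]
    obtain ⟨M₁, h₁⟩ := hmat n (M⁻¹ : GL (Fin n) (R ⊗[k] K)) (congrArg Units.val hM')
    have h01 : M₀ * M₁ = 1 := by
      refine Matrix.map_injective (includeLeft_injective (K := K) (k := k)) ?_
      change (M₀ * M₁).map _ = (1 : Matrix (Fin n) (Fin n) R).map _
      rw [Matrix.map_mul, h₀, h₁, Units.mul_inv, Matrix.map_one _ (map_zero _) (map_one _)]
    exact ⟨⟨M₀, M₁, h01, mul_eq_one_comm.mp h01⟩, Units.ext h₀⟩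
  obtain ⟨a, ha⟩ := hunit 7 g.1 (congrArg Prod.fst hg)
  obtain ⟨b, hb⟩ := hunit 2 g.2 (congrArg Prod.snd hg)
  exact ⟨(a, b), Prod.ext ha hb⟩

end Descent

/-! ### The stabilizer of w_α, by conjugation with g_α and descent. -/

theorem chi_one {R : Type v} [CommRing R] : chi (1 : Amb R) = 1 := by
  rw [← map_one (scalarPair R), chi_scalarPair]

theorem chi_conj {R : Type v} [CommRing R] {g h : Amb R} (hg : g ∈ G R) (hh : h ∈ G R) :
    chi (g⁻¹ * h * g) = chi h := by
  have h1 : chi g⁻¹ * chi g = 1 := by rw [← chi_mul hg, inv_mul_cancel, chi_one]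
  rw [chi_mul hg, chi_mul hh]
  linear_combination chi h * h1

section Descent

variable {k : Type u} [Field k] {K : Type w} [Field K] [CharZero K] [Algebra k K]
variable {R : Type v} [CommRing R] [Algebra k R]

/-- The ring T only has to receive R injectively and K compatibly over k. It is R(α) for descent,
and the coordinate ring of GL(2) × GL(1) over K, with i the identity, for the generic point. -/
theorem mem_stab_wAlpha_iff {α : K} (hα : α ≠ 0) {a : k} (ha : algebraMap k K a = α ^ 2)
    {T : Type*} [CommRing T] {i : R →+* T} {j : K →+* T}
    (hij : i.comp (algebraMap k R) = j.comp (algebraMap k K)) (hi : Function.Injective i)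
    (g : Amb R) : g ∈ stab (wAlpha a) R ↔
      (Amb.map j (gAlpha α hα))⁻¹ * Amb.map i g * Amb.map j (gAlpha α hα) ∈ G T ∧
      rep T ((Amb.map j (gAlpha α hα))⁻¹ * Amb.map i g * Amb.map j (gAlpha α hα)) (wPt T) =
        wPt T := by
  have hγ : Amb.map j (gAlpha α hα) ∈ G T := G_map j (gAlpha_mem_G α hα)
  have hw : ((wAlpha a).map (algebraMap k R)).map i =
      rep T (Amb.map j (gAlpha α hα)) (wPt T) := by
    rw [← wPt_map j, rep_map, ← wAlpha_map α hα ha]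
    ext x y
    exact congrFun (congrArg DFunLike.coe hij) _
  refine and_congr ?_ ?_
  · rw [Subgroup.mul_mem_cancel_right _ hγ, Subgroup.mul_mem_cancel_left _ (inv_mem hγ)]
    exact ⟨fun h => G_map i h, fun h => mem_G_of_map hi h⟩
  · rw [map_mul, map_mul, Module.End.mul_apply, Module.End.mul_apply, ← hw, rep_map]
    have key : ∀ y : V T, rep T (Amb.map j (gAlpha α hα))⁻¹ y = wPt T ↔
        y = rep T (Amb.map j (gAlpha α hα)) (wPt T) := by
      intro y
      constructor
      · intro h
        rw [← h, ← Module.End.mul_apply, ← map_mul, mul_inv_cancel, map_one, Module.End.one_apply]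
      · intro h
        rw [h, ← Module.End.mul_apply, ← map_mul, inv_mul_cancel, map_one, Module.End.one_apply]
    rw [key, ← hw]
    exact (Matrix.map_injective hi).eq_iff.symm

theorem toExt_compat : (Algebra.TensorProduct.includeLeft : R →ₐ[k] (R ⊗[k] K)).toRingHom.comp
    (algebraMap k R) = (Algebra.TensorProduct.includeRight : K →ₐ[k] (R ⊗[k] K)).toRingHom.comp
      (algebraMap k K) := by
  ext x
  change algebraMap k R x ⊗ₜ[k] (1 : K) = (1 : R) ⊗ₜ[k] algebraMap k K x
  rw [Algebra.algebraMap_eq_smul_one, Algebra.algebraMap_eq_smul_one, TensorProduct.smul_tmul]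

theorem isUnit_two_of_ringHom {T : Type*} [CommRing T] (j : K →+* T) : IsUnit (2 : T) := by
  rw [← map_ofNat j 2]
  exact (isUnit_iff_ne_zero.mpr two_ne_zero).map j

theorem chi_sq_of_mem_stab {α : K} (hα : α ≠ 0) {a : k} (ha : algebraMap k K a = α ^ 2)
    {g : Amb R} (hg : g ∈ stab (wAlpha a) R) : chi g ^ 2 = 1 := by
  obtain ⟨h1, h2⟩ := (mem_stab_wAlpha_iff hα ha toExt_compat includeLeft_injective g).mp hg
  have h3 := (stab_wPt_structure (isUnit_two_of_ringHom
    (Algebra.TensorProduct.includeRight : K →ₐ[k] (R ⊗[k] K)).toRingHom) h1 h2).1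
  rw [chi_conj (G_map _ (gAlpha_mem_G α hα)) (G_map _ hg.1), chi_map] at h3
  refine includeLeft_injective (k := k) (K := K) ?_
  rw [map_pow, h3, map_one]

theorem ofField_map_conj {α : K} (hα : α ≠ 0) {σ : K ≃ₐ[k] K} (hσα : σ α = -α) :
    Amb.map (conj σ R) (ofField k R (gAlpha α hα)) =
      ofField k R (gAlpha α hα) * swapPair (R ⊗[k] K) := by
  rw [ofField, Amb.map_map, conj_includeRight, ← Amb.map_map, gAlpha_map α hα _ hσα, map_mul,
    Amb.map_swapPair]

theorem toExt_map_conj (σ : K ≃ₐ[k] K) (g : Amb R) :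
    Amb.map (conj σ R) (toExt k K R g) = toExt k K R g := by
  rw [toExt, Amb.map_map, conj_includeLeft]

theorem exists_of_mem_stab_of_chi_eq_one {α : K} (hα : α ≠ 0) {a : k}
    (ha : algebraMap k K a = α ^ 2) {g : Amb R} (hg : g ∈ stab (wAlpha a) R) (hchi : chi g = 1) :
    ∃ (A : GL (Fin 2) (R ⊗[k] K)) (u : (R ⊗[k] K)ˣ),
      toExt k K R g = ofField k R (gAlpha α hα) * d A * (ofField k R (gAlpha α hα))⁻¹ *
        scalarPair _ u := by
  obtain ⟨h1, h2⟩ := (mem_stab_wAlpha_iff hα ha toExt_compat includeLeft_injective g).mp hg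
  obtain ⟨A, u, h3⟩ := (stab_wPt_structure (isUnit_two_of_ringHom
    (Algebra.TensorProduct.includeRight : K →ₐ[k] (R ⊗[k] K)).toRingHom) h1 h2).2 (by
      rw [chi_conj (G_map _ (gAlpha_mem_G α hα)) (G_map _ hg.1), chi_map, hchi, map_one])
  refine ⟨A, u, ?_⟩
  rw [mul_assoc _ _ (scalarPair _ u), ← scalarPair_mul_comm, ← mul_assoc, mul_assoc _ (d A) _,
    ← h3]
  change toExt k K R g = _ * (_ * toExt k K R g * _) * _
  rw [ofField]
  group

theorem exists_of_mem_stab [CharZero k] {α : K} (hα : α ≠ 0) {a : k}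
    (ha : algebraMap k K a = α ^ 2) (hK : IntermediateField.adjoin k {α} = ⊤) {σ : K ≃ₐ[k] K}
    (hσ : σ ≠ 1) {g : Amb R} (hg : g ∈ stab (wAlpha a) R) (hchi : chi g = 1) :
    ∃ A ∈ U11 σ R, ∃ t ∈ tildeT R,
      toExt k K R g = ofField k R (gAlpha α hα) * d A * (ofField k R (gAlpha α hα))⁻¹ *
        toExt k K R t := by
  obtain ⟨A, u, h⟩ := exists_of_mem_stab_of_chi_eq_one hα ha hg hchi
  have hσα := apply_eq_neg_of_ne_one ⟨a, ha⟩ hK hσ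
  have h' := congrArg (Amb.map (conj σ R)) h
  rw [toExt_map_conj, h, map_mul, map_mul, map_mul, map_inv, ofField_map_conj hα hσα,
    Amb.map_d, Amb.map_scalarPair] at h'
  -- Comparing g with its conjugate: the cocycle contributes conjugation by the swap, which turns
  -- d(A) into d(θ(A)); the scalars are central. Uniqueness of (A, u) then gives σ(A) = θ(A) and
  -- σ(u) = u.
  have key : d (theta A) * scalarPair _ u =
      d (Matrix.GeneralLinearGroup.map (conj σ R) A) *
        scalarPair _ (Units.map (conj σ R : R ⊗[k] K →* R ⊗[k] K) u) := by
    have e1 : d (theta A) = (swapPair (R ⊗[k] K))⁻¹ * d A * swapPair (R ⊗[k] K) := by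
      rw [mul_assoc, d_mul_swapPair, inv_mul_cancel_left]
    have e2 := scalarPair_mul_comm u (swapPair (R ⊗[k] K))
    have e3 := scalarPair_mul_comm u (ofField k R (gAlpha α hα))
    have e4 := scalarPair_mul_comm (Units.map (conj σ R : R ⊗[k] K →* R ⊗[k] K) u)
      (ofField k R (gAlpha α hα) * swapPair (R ⊗[k] K))
    generalize scalarPair (R ⊗[k] K) u = t at *
    generalize swapPair (R ⊗[k] K) = s at *
    generalize ofField k R (gAlpha α hα) = γ at *
    have f3 : γ⁻¹ * t = t * γ⁻¹ := (show Commute γ t from e3.symm).inv_left.eq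
    have f4 := (show Commute (γ * s) _ from e4.symm).inv_left.eq
    rw [mul_assoc _ γ⁻¹ t, f3, mul_assoc _ (γ * s)⁻¹, f4] at h'
    calc d (theta A) * t = s⁻¹ * γ⁻¹ * (γ * d A * (t * γ⁻¹)) * γ * s := by
          rw [e1, mul_assoc _ s t, ← e2]
          group
      _ = _ := by
          rw [h']
          group
  obtain ⟨hA, hu⟩ := d_mul_scalarPair_injective key
  have hσu : conj σ R (u : R ⊗[k] K) = u := congrArg Units.val hu.symm
  have hσu' : conj σ R ((u⁻¹ : (R ⊗[k] K)ˣ) : R ⊗[k] K) = ((u⁻¹ : (R ⊗[k] K)ˣ) : R ⊗[k] K) :=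
    congrArg Units.val ((map_inv (Units.map (conj σ R : R ⊗[k] K →* R ⊗[k] K)) u).trans
      (congrArg (·⁻¹) hu.symm))
  obtain ⟨r, hr⟩ := exists_includeLeft_eq ⟨a, ha⟩ hK hσ hσu
  obtain ⟨r', hr'⟩ := exists_includeLeft_eq ⟨a, ha⟩ hK hσ hσu'
  have hrr : r * r' = 1 := by
    refine includeLeft_injective (k := k) (K := K) ?_
    change (r * r') ⊗ₜ[k] (1 : K) = (1 : R) ⊗ₜ[k] (1 : K)
    rw [← Algebra.TensorProduct.one_def, ← u.mul_inv, ← hr, ← hr',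
      Algebra.TensorProduct.tmul_mul_tmul, mul_one]
  refine ⟨A, (mem_unitaryOf_iff _ _).mpr hA.symm, scalarPair R ⟨r, r', hrr, by
    rw [mul_comm, hrr]⟩, scalarPair_mem_tildeT _, ?_⟩
  rw [h, toExt, Amb.map_scalarPair]
  congr 2
  exact Units.ext hr.symm

theorem exists_mem_stab [CharZero k] {α : K} (hα : α ≠ 0) {a : k}
    (ha : algebraMap k K a = α ^ 2) (hK : IntermediateField.adjoin k {α} = ⊤) {σ : K ≃ₐ[k] K}
    (hσ : σ ≠ 1) {A : GL (Fin 2) (R ⊗[k] K)} (hA : A ∈ U11 σ R) {t : Amb R} (ht : t ∈ tildeT R) :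
    ∃ g ∈ stab (wAlpha a) R, chi g = 1 ∧
      toExt k K R g = ofField k R (gAlpha α hα) * d A * (ofField k R (gAlpha α hα))⁻¹ *
        toExt k K R t := by
  have hσα := apply_eq_neg_of_ne_one ⟨a, ha⟩ hK hσ
  obtain ⟨u, rfl⟩ := (mem_tildeT_iff t).mp ht
  -- Here σ(A) = θ(A), so the swap coming from g_α cancels and the element is σ-invariant.
  have hfix : Amb.map (conj σ R) (ofField k R (gAlpha α hα) * d A *
      (ofField k R (gAlpha α hα))⁻¹ * toExt k K R (scalarPair R u)) =
      ofField k R (gAlpha α hα) * d A *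
      (ofField k R (gAlpha α hα))⁻¹ * toExt k K R (scalarPair R u) := by
    rw [map_mul, map_mul, map_mul, map_inv, ofField_map_conj hα hσα, Amb.map_d,
      (mem_unitaryOf_iff _ _).mp hA, toExt_map_conj, mul_inv_rev, mul_assoc _ _ (d (theta A)),
      ← d_mul_swapPair]
    group
  obtain ⟨g, hg⟩ := exists_toExt_eq ⟨a, ha⟩ hK hσ hfix
  have hconj : (ofField k R (gAlpha α hα))⁻¹ * toExt k K R g * ofField k R (gAlpha α hα) =
      d A * toExt k K R (scalarPair R u) := by
    have e := scalarPair_mul_comm (Units.map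
      (Algebra.TensorProduct.includeLeft : R →ₐ[k] (R ⊗[k] K)).toRingHom u)
      (ofField k R (gAlpha α hα))
    rw [← Amb.map_scalarPair] at e
    change toExt k K R (scalarPair R u) * _ = _ * toExt k K R (scalarPair R u) at e
    rw [hg, mul_assoc, mul_assoc _ (toExt k K R (scalarPair R u)), e]
    group
  have hmem : g ∈ stab (wAlpha a) R := by
    refine (mem_stab_wAlpha_iff hα ha toExt_compat includeLeft_injective g).mpr ?_
    change (ofField k R (gAlpha α hα))⁻¹ * toExt k K R g * ofField k R (gAlpha α hα) ∈ _ ∧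
      rep _ ((ofField k R (gAlpha α hα))⁻¹ * toExt k K R g * ofField k R (gAlpha α hα)) _ = _
    rw [hconj, toExt, Amb.map_scalarPair]
    refine ⟨mul_mem (d_mem_G A) (scalarPair_mem_tildeT _).1, ?_⟩
    rw [map_mul, MonoidHom.mem_ker.mp (scalarPair_mem_tildeT _).2, mul_one, rep_d]
  refine ⟨g, hmem, includeLeft_injective (k := k) (K := K) ?_, hg⟩
  rw [← chi_map, ← chi_conj (G_map _ (gAlpha_mem_G α hα)) (G_map _ hmem.1), map_one]
  change chi ((ofField k R (gAlpha α hα))⁻¹ * toExt k K R g * ofField k R (gAlpha α hα)) = 1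
  rw [hconj, toExt, Amb.map_scalarPair, chi_mul (scalarPair_mem_tildeT _).1, chi_d,
    chi_scalarPair, mul_one]

end Descent

/-! ### Points of the spectrum attached to R-points. -/

section Spec

variable {k : Type u} [Field k]

theorem map_evalAt {R : Type*} [CommRing R] [Algebra k R] {S : Type*} [CommRing S] [Algebra k S]
    {f : R →+* S} (hf : f.comp (algebraMap k R) = algebraMap k S) (g : Amb R)
    (P : MvPolynomial Coord k) : evalAt k (Amb.map f g) P = f (evalAt k g P) := by
  have h : (evalAt k (Amb.map f g)).toRingHom = f.comp (evalAt k g).toRingHom := by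
    refine MvPolynomial.ringHom_ext (fun c => ?_) (fun c => ?_)
    · simp only [evalAt, AlgHom.toRingHom_eq_coe, RingHom.comp_apply, RingHom.coe_coe,
        MvPolynomial.algHom_C]
      exact (congrArg (fun h : k →+* S => h c) hf).symm
    · rcases c with c | c
      · simp [evalAt, Amb.map]
      · simp [evalAt, Amb.map]
  exact congrArg (fun h : MvPolynomial Coord k →+* S => h P) h

theorem mem_specPoint {R : Type*} [CommRing R] [Algebra k R] (g : Amb R) (q : PrimeSpectrum R)
    (P : MvPolynomial Coord k) :
    P ∈ (specPoint k g q).asIdeal ↔ evalAt k g P ∈ q.asIdeal := Iff.rfl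

theorem stab_map {x : V k} {R : Type*} [CommRing R] [Algebra k R] {S : Type*} [CommRing S]
    [Algebra k S] {f : R →+* S} (hf : f.comp (algebraMap k R) = algebraMap k S) {g : Amb R}
    (hg : g ∈ stab x R) : Amb.map f g ∈ stab x S := by
  have hx : x.map (algebraMap k S) = (x.map (algebraMap k R)).map f := by
    rw [← hf]
    rfl
  refine ⟨G_map f hg.1, ?_⟩
  rw [hx, rep_map, hg.2]

theorem mem_stab_of_map {x : V k} {R : Type*} [CommRing R] [Algebra k R] {S : Type*} [CommRing S]
    [Algebra k S] {f : R →+* S} (hf : f.comp (algebraMap k R) = algebraMap k S)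
    (hinj : Function.Injective f) {g : Amb R}
    (hg : Amb.map f g ∈ stab x S) : g ∈ stab x R := by
  have hx : x.map (algebraMap k S) = (x.map (algebraMap k R)).map f := by
    rw [← hf]
    rfl
  refine ⟨mem_G_of_map hinj hg.1, Matrix.map_injective hinj ?_⟩
  have h := hg.2
  rwa [hx, rep_map] at h

/-- The obvious witness, the residue field of q, may lie in the wrong universe. The residue field F
of the image point p lies in the right one and embeds in it; the coordinates of g mod q come from F,
and stabilizer membership descends along the embedding. -/
theorem specPoint_mem_stabSpace {x : V k} {R : Type*} [CommRing R] [Algebra k R] {g : Amb R}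
    (hg : g ∈ stab x R) (q : PrimeSpectrum R) : specPoint k g q ∈ stabSpace x := by
  let p := specPoint k g q
  let F := p.asIdeal.ResidueField
  let L := q.asIdeal.ResidueField
  let π := algebraMap (MvPolynomial Coord k) F
  let φ : F →ₐ[k] L := Ideal.ResidueField.mapₐ p.asIdeal q.asIdeal (evalAt k g) rfl
  have hφ : ∀ P, φ (π P) = algebraMap R L (evalAt k g P) := fun P =>
    Ideal.ResidueField.map_algebraMap _ _ _ _ _
  have hφinj : Function.Injective φ.toRingHom := φ.toRingHom.injective
  have hφk : φ.toRingHom.comp (algebraMap k F) = algebraMap k L := φ.comp_algebraMap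
  have hLk : (algebraMap R L).comp (algebraMap k R) = algebraMap k L :=
    (IsScalarTower.algebraMap_eq k R L).symm
  let M : Matrix (Fin 7) (Fin 7) F := Matrix.of fun i j => π (MvPolynomial.X (Sum.inl (i, j)))
  let N : Matrix (Fin 2) (Fin 2) F := Matrix.of fun i j => π (MvPolynomial.X (Sum.inr (i, j)))
  have hM : M.map φ.toRingHom = (g.1 : Matrix (Fin 7) (Fin 7) R).map (algebraMap R L) := by
    ext i j
    exact (hφ _).trans (by simp [evalAt])
  have hN : N.map φ.toRingHom = (g.2 : Matrix (Fin 2) (Fin 2) R).map (algebraMap R L) := by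
    ext i j
    exact (hφ _).trans (by simp [evalAt])
  have hdet : ∀ {n : ℕ} (A : Matrix (Fin n) (Fin n) F) (B : GL (Fin n) R),
      A.map φ.toRingHom = (B : Matrix (Fin n) (Fin n) R).map (algebraMap R L) → A.det ≠ 0 := by
    intro n A B hAB h0
    have h1 : (A.map φ.toRingHom).det = 0 := by
      rw [← RingHom.mapMatrix_apply, ← RingHom.map_det, h0, map_zero]
    rw [hAB, ← RingHom.mapMatrix_apply, ← RingHom.map_det] at h1
    exact (((Matrix.isUnit_iff_isUnit_det _).mp B.isUnit).map (algebraMap R L)).ne_zero h1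
  let g' : Amb F := (Matrix.GeneralLinearGroup.mkOfDetNeZero M (hdet M g.1 hM),
    Matrix.GeneralLinearGroup.mkOfDetNeZero N (hdet N g.2 hN))
  have hg' : Amb.map φ.toRingHom g' = Amb.map (algebraMap R L) g := Amb.ext hM hN
  refine ⟨F, inferInstance, inferInstance, g', mem_stab_of_map hφk hφinj ?_, ?_⟩
  · rw [hg']
    exact stab_map hLk hg
  · have hev : (evalAt k g').toRingHom = π := by
      refine MvPolynomial.ringHom_ext (fun c => ?_) (fun c => ?_)
      · simp only [evalAt, AlgHom.toRingHom_eq_coe, RingHom.coe_coe, MvPolynomial.algHom_C]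
        exact IsScalarTower.algebraMap_apply k (MvPolynomial Coord k) F c
      · rcases c with c | c
        · simp only [evalAt, AlgHom.toRingHom_eq_coe, RingHom.coe_coe, MvPolynomial.aeval_X]
          rfl
        · simp only [evalAt, AlgHom.toRingHom_eq_coe, RingHom.coe_coe, MvPolynomial.aeval_X]
          rfl
    ext P
    change P ∈ p.asIdeal ↔ (evalAt k g').toRingHom P ∈ (⊥ : Ideal F)
    rw [hev, Ideal.mem_bot]
    exact Ideal.algebraMap_residueField_eq_zero.symm

variable (k) in
/-- The polynomial in the matrix coordinates defining `χ`. -/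
noncomputable def chiPoly : MvPolynomial Coord k :=
  wCoord (Matrix.of fun i j : Fin 7 => MvPolynomial.X (Sum.inl (i, j))) 1 2 3 ^ 2 *
    (Matrix.of fun i j : Fin 2 => MvPolynomial.X (Sum.inr (i, j)) :
      Matrix (Fin 2) (Fin 2) (MvPolynomial Coord k)).det ^ 3

theorem evalAt_chiPoly {R : Type*} [CommRing R] [Algebra k R] (g : Amb R) :
    evalAt k g (chiPoly k) = chi g := by
  rw [chiPoly, map_mul, map_pow, map_pow, Matrix.det_fin_two]
  have h := map_wCoord (evalAt k g).toRingHom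
    (Matrix.of fun i j : Fin 7 => (MvPolynomial.X (Sum.inl (i, j)) : MvPolynomial Coord k)) 1 2 3
  refine congrArg₂ (· ^ 2 * · ^ 3) (h.symm.trans (congrArg (fun M => wCoord M 1 2 3) ?_)) ?_
  · ext i j
    simp [evalAt]
  · rw [Matrix.det_fin_two]
    simp [evalAt]

end Spec

/-! ### The locus χ = 1 is the identity component. -/

section Component

variable {k : Type u} [Field k] {K : Type w} [Field K] [CharZero K] [Algebra k K]

theorem chiPoly_sub_one_or_add_one_mem {α : K} (hα : α ≠ 0) {a : k} (ha : algebraMap k K a = α ^ 2)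
    {p : PrimeSpectrum (MvPolynomial Coord k)} (hp : p ∈ stabSpace (wAlpha a)) :
    chiPoly k - 1 ∈ p.asIdeal ∨ chiPoly k + 1 ∈ p.asIdeal := by
  obtain ⟨F, _, _, g, hg, rfl⟩ := hp
  rw [mem_specPoint, mem_specPoint, map_add, map_sub, evalAt_chiPoly, map_one]
  change _ ∈ (⊥ : Ideal F) ∨ _ ∈ (⊥ : Ideal F)
  rw [Ideal.mem_bot, Ideal.mem_bot, ← mul_eq_zero]
  linear_combination chi_sq_of_mem_stab hα ha hg

theorem two_notMem_of_algebra [CharZero k] {R : Type*} [CommRing R] [Algebra k R]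
    (q : PrimeSpectrum R) : (2 : R) ∉ q.asIdeal := fun h =>
  q.isPrime.ne_top (Ideal.eq_top_of_isUnit_mem _ h (isUnit_two_of_ringHom (algebraMap k R)))

/-- V(χ − 1) and V(χ + 1) are closed, cover the space and are disjoint because 2 is a unit; a
connected set containing the point 1 lies in the first. -/
theorem chiPoly_mem_of_mem_component [CharZero k] {α : K} (hα : α ≠ 0) {a : k}
    (ha : algebraMap k K a = α ^ 2) {p : PrimeSpectrum (MvPolynomial Coord k)}
    (hp : p ∈ connectedComponentIn (stabSpace (wAlpha a)) (specPoint k (1 : Amb k) ⊥)) :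
    chiPoly k - 1 ∈ p.asIdeal := by
  have hsub := connectedComponentIn_subset (stabSpace (wAlpha a)) (specPoint k (1 : Amb k) ⊥)
  have hone : specPoint k (1 : Amb k) ⊥ ∈ stabSpace (wAlpha a) :=
    specPoint_mem_stabSpace (one_mem _) _
  have hmem : ∀ f (x : PrimeSpectrum (MvPolynomial Coord k)),
      x ∈ PrimeSpectrum.zeroLocus {f} ↔ f ∈ x.asIdeal := fun f x => by
    rw [PrimeSpectrum.mem_zeroLocus, Set.singleton_subset_iff]
    rfl
  rcases isPreconnected_iff_subset_of_disjoint_closed.mp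
    (isPreconnected_connectedComponentIn (x := specPoint k (1 : Amb k) ⊥)
      (F := stabSpace (wAlpha a)))
    (PrimeSpectrum.zeroLocus {chiPoly k - 1}) (PrimeSpectrum.zeroLocus {chiPoly k + 1})
    (PrimeSpectrum.isClosed_zeroLocus _) (PrimeSpectrum.isClosed_zeroLocus _)
    (fun x hx => by
      rw [Set.mem_union, hmem, hmem]
      exact chiPoly_sub_one_or_add_one_mem hα ha (hsub hx))
    (Set.eq_empty_of_forall_notMem fun x ⟨_, hx1, hx2⟩ => by
      rw [hmem] at hx1 hx2
      refine two_notMem_of_algebra (k := k) x ?_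
      convert sub_mem hx2 hx1 using 1
      ring) with h | h
  · exact (hmem _ _).mp (h hp)
  · have h1 := (hmem _ _).mp (h (mem_connectedComponentIn hone))
    rw [mem_specPoint, map_add, evalAt_chiPoly, chi_one, map_one, one_add_one_eq_two] at h1
    exact absurd h1 (two_notMem_of_algebra (k := k) _)

variable (K) in
/-- The determinant of the generic `2 × 2` matrix times a further variable. -/
noncomputable def genericDisc : MvPolynomial (Fin 5) K :=
  (MvPolynomial.X 0 * MvPolynomial.X 3 - MvPolynomial.X 1 * MvPolynomial.X 2) * MvPolynomial.X 4

theorem genericDisc_ne_zero : genericDisc K ≠ 0 := by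
  intro h
  have h1 := congrArg (MvPolynomial.eval ![(1 : K), 0, 0, 1, 1]) h
  simp [genericDisc] at h1

variable (K) in
/-- The coordinate ring of `GL(2) × GL(1)`. -/
abbrev GenericRing : Type w := Localization.Away (genericDisc K)

instance : IsDomain (GenericRing K) :=
  IsLocalization.isDomain_localization (powers_le_nonZeroDivisors_of_noZeroDivisors
    genericDisc_ne_zero)

variable (K) in
/-- The `i`-th coordinate of the generic point of `GL(2) × GL(1)`. -/
noncomputable def genericVar (i : Fin 5) : GenericRing K :=
  algebraMap (MvPolynomial (Fin 5) K) (GenericRing K) (MvPolynomial.X i)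

theorem isUnit_genericDisc : IsUnit ((genericVar K 0 * genericVar K 3 -
    genericVar K 1 * genericVar K 2) * genericVar K 4) := by
  have h := IsLocalization.Away.algebraMap_isUnit (S := GenericRing K) (genericDisc K)
  have e : algebraMap (MvPolynomial (Fin 5) K) (GenericRing K) (genericDisc K) =
      (genericVar K 0 * genericVar K 3 - genericVar K 1 * genericVar K 2) * genericVar K 4 := by
    simp only [genericVar, ← map_mul, ← map_sub]
    rfl
  rwa [e] at h

/-- For every invertible matrix `A` and every unit `u` over a ring containing `K` there is a
specialization of the generic point of `GL(2) × GL(1)` at `(A, u)`. -/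
theorem exists_specialization {S : Type*} [CommRing S] (j : K →+* S) (A : GL (Fin 2) S) (u : Sˣ) :
    ∃ ψ : GenericRing K →+* S, ψ.comp (algebraMap K (GenericRing K)) = j ∧
      ∀ i, ψ (genericVar K i) = ![A 0 0, A 0 1, A 1 0, A 1 1, u] i := by
  let φ := MvPolynomial.eval₂Hom j ![A 0 0, A 0 1, A 1 0, A 1 1, (u : S)]
  have hφ : IsUnit (φ (genericDisc K)) := by
    have h : φ (genericDisc K) = (A : Matrix (Fin 2) (Fin 2) S).det * u := by
      rw [Matrix.det_fin_two]
      simp [φ, genericDisc]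
    rw [h]
    exact ((Matrix.isUnit_iff_isUnit_det _).mp A.isUnit).mul u.isUnit
  refine ⟨IsLocalization.Away.lift (genericDisc K) hφ, ?_, fun i => ?_⟩
  · ext c
    rw [RingHom.comp_apply, IsScalarTower.algebraMap_apply K (MvPolynomial (Fin 5) K),
      IsLocalization.Away.lift_eq]
    exact MvPolynomial.eval₂Hom_C _ _ _
  · rw [genericVar, IsLocalization.Away.lift_eq]
    exact MvPolynomial.eval₂Hom_X' _ _ _

variable (K) in
/-- The generic invertible matrix. -/
noncomputable def genericMat : GL (Fin 2) (GenericRing K) :=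
  Matrix.GeneralLinearGroup.mk'' !![genericVar K 0, genericVar K 1; genericVar K 2, genericVar K 3]
    (by
      rw [Matrix.det_fin_two_of]
      exact isUnit_of_mul_isUnit_left isUnit_genericDisc)

variable (K) in
/-- The generic unit. -/
noncomputable def genericUnit : (GenericRing K)ˣ :=
  (isUnit_of_mul_isUnit_right (isUnit_genericDisc (K := K))).unit

/-- The generic point of the identity component of the stabilizer. -/
noncomputable def genericPt (α : K) (hα : α ≠ 0) : Amb (GenericRing K) :=
  Amb.map (algebraMap K (GenericRing K)) (gAlpha α hα) * d (genericMat K) *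
    (Amb.map (algebraMap K (GenericRing K)) (gAlpha α hα))⁻¹ *
    scalarPair (GenericRing K) (genericUnit K)

theorem algebraMap_genericRing : algebraMap k (GenericRing K) =
    (algebraMap K (GenericRing K)).comp (algebraMap k K) :=
  IsScalarTower.algebraMap_eq k K (GenericRing K)

theorem genericPt_mem_stab {α : K} (hα : α ≠ 0) {a : k} (ha : algebraMap k K a = α ^ 2) :
    genericPt α hα ∈ stab (wAlpha a) (GenericRing K) := by
  refine (mem_stab_wAlpha_iff hα ha (i := RingHom.id _) (j := algebraMap K (GenericRing K))
    ((RingHom.id_comp _).trans algebraMap_genericRing) Function.injective_id _).mpr ?_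
  have hid : Amb.map (RingHom.id (GenericRing K)) (genericPt α hα) = genericPt α hα := rfl
  have h : (Amb.map (algebraMap K (GenericRing K)) (gAlpha α hα))⁻¹ * genericPt α hα *
      Amb.map (algebraMap K (GenericRing K)) (gAlpha α hα) =
      d (genericMat K) * scalarPair (GenericRing K) (genericUnit K) := by
    rw [genericPt, mul_assoc, mul_assoc _ (scalarPair _ _), scalarPair_mul_comm]
    group
  rw [hid, h]
  refine ⟨mul_mem (d_mem_G _) (scalarPair_mem_tildeT _).1, ?_⟩
  rw [map_mul, MonoidHom.mem_ker.mp (scalarPair_mem_tildeT _).2, mul_one, rep_d]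

/-- A polynomial vanishing at the generic element vanishes at each of its specializations, in
particular at g over R(α). Since R embeds in R(α), it vanishes at g over R, hence modulo every prime
q. -/
theorem genericPt_le {α : K} (hα : α ≠ 0) {a : k} (ha : algebraMap k K a = α ^ 2)
    {R : Type v} [CommRing R] [Algebra k R] {g : Amb R} (hg : g ∈ stab (wAlpha a) R)
    (hchi : chi g = 1) (q : PrimeSpectrum R) :
    specPoint k (genericPt α hα) ⊥ ≤ specPoint k g q := by
  obtain ⟨A, u, h⟩ := exists_of_mem_stab_of_chi_eq_one hα ha hg hchi
  obtain ⟨ψ, hψ, hvar⟩ := exists_specialization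
    (Algebra.TensorProduct.includeRight : K →ₐ[k] (R ⊗[k] K)).toRingHom A u
  have hA : Matrix.GeneralLinearGroup.map ψ (genericMat K) = A := by
    refine Units.ext ?_
    ext i j
    fin_cases i <;> fin_cases j
    exacts [hvar 0, hvar 1, hvar 2, hvar 3]
  have hu : Units.map ψ.toMonoidHom (genericUnit K) = u := Units.ext (hvar 4)
  have hmap : Amb.map ψ (genericPt α hα) = toExt k K R g := by
    rw [genericPt, map_mul, map_mul, map_mul, map_inv, Amb.map_map, hψ, Amb.map_d, hA,
      Amb.map_scalarPair, h]
    congr 2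
  intro P hP
  have hP : evalAt k (genericPt α hα) P = 0 := hP
  have h0 : evalAt k (toExt k K R g) P = 0 := by
    rw [← hmap, map_evalAt ?_, hP, map_zero]
    rw [algebraMap_genericRing, ← RingHom.comp_assoc, hψ, ← toExt_compat]
    rfl
  rw [toExt, map_evalAt rfl] at h0
  rw [mem_specPoint, includeLeft_injective (k := k) (K := K) (h0.trans (map_zero _).symm)]
  exact zero_mem _

theorem mem_stabIdentityComponent_iff [CharZero k] {α : K} (hα : α ≠ 0) {a : k}
    (ha : algebraMap k K a = α ^ 2) {R : Type v} [CommRing R] [Algebra k R] (g : Amb R) :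
    g ∈ stabIdentityComponent (wAlpha a) R ↔ g ∈ stab (wAlpha a) R ∧ chi g = 1 := by
  refine and_congr_right fun hg => ⟨fun h => ?_, fun h q => ?_⟩
  -- The topology only gives χ − 1 in every prime, so χ − 1 could still be nilpotent. But χ + 1 then
  -- avoids every prime, hence is a unit, and (χ − 1)(χ + 1) = 0 finishes.
  · have hunit : IsUnit (chi g + 1) := by
      by_contra hnu
      obtain ⟨m, hm, hmem⟩ := exists_max_ideal_of_mem_nonunits hnu
      let q : PrimeSpectrum R := ⟨m, hm.isPrime⟩
      have h1 := chiPoly_mem_of_mem_component hα ha (h q)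
      rw [mem_specPoint, map_sub, evalAt_chiPoly, map_one] at h1
      refine two_notMem_of_algebra (k := k) q ?_
      convert sub_mem (show chi g + 1 ∈ q.asIdeal from hmem) h1 using 1
      ring
    refine sub_eq_zero.mp (hunit.mul_left_eq_zero.mp ?_)
    linear_combination chi_sq_of_mem_stab hα ha hg
  · have hle := genericPt_le hα ha hg h q
    have hle1 := genericPt_le hα ha (one_mem (stab (wAlpha a) k)) chi_one ⊥
    -- A set lying between a point and its closure is connected; this one contains both the point of
    -- 1 and that of g at q.
    have hpre : IsPreconnected (stabSpace (wAlpha a) ∩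
        closure {specPoint k (genericPt α hα) ⊥}) :=
      isPreconnected_singleton.subset_closure
        (Set.singleton_subset_iff.mpr ⟨specPoint_mem_stabSpace (genericPt_mem_stab hα ha) _,
          subset_closure rfl⟩) Set.inter_subset_right
    exact hpre.subset_connectedComponentIn
      ⟨specPoint_mem_stabSpace (one_mem _) _, (PrimeSpectrum.le_iff_mem_closure _ _).mp hle1⟩
      Set.inter_subset_left
      ⟨specPoint_mem_stabSpace hg _, (PrimeSpectrum.le_iff_mem_closure _ _).mp hle⟩

end Component

/-! ### The isomorphism with U_α(1,1) × T̃ and its naturality. -/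

section Main

variable {k : Type u} [Field k] [CharZero k] {K : Type w} [Field K] [CharZero K] [Algebra k K]

/-- The subgroup `χ = 1` of the stabilizer of `w_α`. -/
noncomputable def chiKer (a : k) (R : Type v) [CommRing R] [Algebra k R] : Subgroup (Amb R) where
  carrier := {g | g ∈ stab (wAlpha a) R ∧ chi g = 1}
  one_mem' := ⟨one_mem _, chi_one⟩
  mul_mem' := by
    rintro g h ⟨hg, hg'⟩ ⟨hh, hh'⟩
    exact ⟨mul_mem hg hh, by rw [chi_mul hh.1, hg', hh', mul_one]⟩
  inv_mem' := by
    rintro g ⟨hg, hg'⟩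
    refine ⟨inv_mem hg, ?_⟩
    have h := chi_mul (g := g⁻¹) hg.1
    rw [inv_mul_cancel, chi_one, hg', mul_one] at h
    exact h.symm

/-- The homomorphism `(A, t) ↦ g_α d(A) g_α⁻¹ t`. -/
noncomputable def unitaryProd (α : K) (hα : α ≠ 0) (σ : K ≃ₐ[k] K) (R : Type v) [CommRing R]
    [Algebra k R] : U11 σ R × tildeT R →* Amb (R ⊗[k] K) :=
  MonoidHom.noncommCoprod
    ((MulAut.conj (ofField k R (gAlpha α hα))).toMonoidHom.comp (d.comp (U11 σ R).subtype))
    ((toExt k K R).comp (tildeT R).subtype) (by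
      rintro A ⟨t, ht⟩
      obtain ⟨u, rfl⟩ := (mem_tildeT_iff t).mp ht
      refine Commute.symm ?_
      change toExt k K R (scalarPair R u) * _ = _ * toExt k K R (scalarPair R u)
      rw [toExt, Amb.map_scalarPair]
      exact scalarPair_mul_comm _ _)

theorem unitaryProd_apply {α : K} (hα : α ≠ 0) (σ : K ≃ₐ[k] K) {R : Type v} [CommRing R]
    [Algebra k R] (A : U11 σ R) (t : tildeT R) : unitaryProd α hα σ R (A, t) =
      ofField k R (gAlpha α hα) * d (A : GL (Fin 2) (R ⊗[k] K)) *
        (ofField k R (gAlpha α hα))⁻¹ * toExt k K R t := rfl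

theorem unitaryProd_injective {α : K} (hα : α ≠ 0) (σ : K ≃ₐ[k] K) (R : Type v) [CommRing R]
    [Algebra k R] : Function.Injective (unitaryProd α hα σ R) := by
  rw [injective_iff_map_eq_one]
  rintro ⟨A, t, ht⟩ h
  obtain ⟨u, rfl⟩ := (mem_tildeT_iff t).mp ht
  rw [unitaryProd_apply, toExt, Amb.map_scalarPair, mul_assoc, ← scalarPair_mul_comm,
    mul_assoc, ← mul_assoc (d _), ← mul_assoc, conj_eq_one_iff] at h
  obtain ⟨hA, hu⟩ := d_mul_scalarPair_injective (h.trans (by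
    rw [map_one, map_one, mul_one] : _ = d 1 * scalarPair _ 1))
  refine Prod.ext (Subtype.ext hA) (Subtype.ext (toExt_injective (k := k) (K := K) ?_))
  change toExt k K R (scalarPair R u) = toExt k K R 1
  rw [toExt, Amb.map_scalarPair, map_one]
  exact (congrArg (scalarPair _) hu).trans (map_one _)

/-- Both inclusions are descent; equality of images inside R(α)-points lets the isomorphism be
defined over R without choosing preimages. -/
theorem unitaryProd_range {α : K} (hα : α ≠ 0) {a : k} (ha : algebraMap k K a = α ^ 2)
    (hK : IntermediateField.adjoin k {α} = ⊤) {σ : K ≃ₐ[k] K} (hσ : σ ≠ 1) (R : Type v)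
    [CommRing R] [Algebra k R] :
    (unitaryProd α hα σ R).range = (chiKer a R).map (toExt k K R) := by
  ext h
  constructor
  · rintro ⟨⟨A, t⟩, rfl⟩
    obtain ⟨g, hg, hchi, hgt⟩ := exists_mem_stab hα ha hK hσ A.2 t.2
    exact ⟨g, ⟨hg, hchi⟩, hgt⟩
  · rintro ⟨g, ⟨hg, hchi⟩, rfl⟩
    obtain ⟨A, hA, t, ht, h⟩ := exists_of_mem_stab hα ha hK hσ hg hchi
    exact ⟨(⟨A, hA⟩, ⟨t, ht⟩), h.symm⟩

/-- The isomorphism from `U_α(1,1) × T̃` onto the subgroup `χ = 1` of the stabilizer. -/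
noncomputable def unitaryProdEquiv {α : K} (hα : α ≠ 0) {a : k} (ha : algebraMap k K a = α ^ 2)
    (hK : IntermediateField.adjoin k {α} = ⊤) {σ : K ≃ₐ[k] K} (hσ : σ ≠ 1) (R : Type v)
    [CommRing R] [Algebra k R] : U11 σ R × tildeT R ≃* chiKer a R :=
  ((MonoidHom.ofInjective (unitaryProd_injective hα σ R)).trans
    (MulEquiv.subgroupCongr (unitaryProd_range hα ha hK hσ R))).trans
      ((chiKer a R).equivMapOfInjective (toExt k K R) toExt_injective).symm

theorem toExt_unitaryProdEquiv {α : K} (hα : α ≠ 0) {a : k} (ha : algebraMap k K a = α ^ 2)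
    (hK : IntermediateField.adjoin k {α} = ⊤) {σ : K ≃ₐ[k] K} (hσ : σ ≠ 1) {R : Type v}
    [CommRing R] [Algebra k R] (x : U11 σ R × tildeT R) :
    toExt k K R (unitaryProdEquiv hα ha hK hσ R x) = unitaryProd α hα σ R x := by
  have h := ((chiKer a R).equivMapOfInjective (toExt k K R)
    toExt_injective).apply_symm_apply (MulEquiv.subgroupCongr (unitaryProd_range hα ha hK hσ R)
      (MonoidHom.ofInjective (unitaryProd_injective hα σ R) x))
  exact congrArg Subtype.val h

theorem toExt_map {R R' : Type v} [CommRing R] [Algebra k R] [CommRing R'] [Algebra k R']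
    (f : R →ₐ[k] R') (g : Amb R) :
    toExt k K R' (Amb.map f.toRingHom g) = Amb.map (extMap K f) (toExt k K R g) := by
  rw [toExt, toExt, Amb.map_map, Amb.map_map]
  congr 1

theorem unitaryProd_map {α : K} (hα : α ≠ 0) (σ : K ≃ₐ[k] K) {R R' : Type v} [CommRing R]
    [Algebra k R] [CommRing R'] [Algebra k R'] (f : R →ₐ[k] R') (A : U11 σ R) (t : tildeT R) :
    unitaryProd α hα σ R' (U11Map σ f A, tildeTMap f.toRingHom t) =
      Amb.map (extMap K f) (unitaryProd α hα σ R (A, t)) := by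
  rw [unitaryProd_apply, unitaryProd_apply, map_mul, map_mul, map_mul, map_inv, ← toExt_map,
    Amb.map_d]
  have h : Amb.map (extMap K f) (ofField k R (gAlpha α hα)) = ofField k R' (gAlpha α hα) := by
    have e : (extMap K f).comp (Algebra.TensorProduct.includeRight : K →ₐ[k] (R ⊗[k] K)).toRingHom =
        (Algebra.TensorProduct.includeRight : K →ₐ[k] (R' ⊗[k] K)).toRingHom := by
      ext z
      simp [extMap]
    rw [ofField, ofField, Amb.map_map, e]
  rw [h]
  rfl

end Main

end PrehomG2

theorem mainTheorem5 {k : Type u} [Field k] [CharZero k]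
    {K : Type w} [Field K] [CharZero K] [Algebra k K]
    (α : K) (hα : α ∉ Set.range (algebraMap k K)) (hα2 : α ^ 2 ∈ Set.range (algebraMap k K))
    (hK : IntermediateField.adjoin k {α} = ⊤)
    (σ : K ≃ₐ[k] K) (hσ : σ ≠ 1) :
    -- the point `w_α = g_α w` is `k`-rational
    ∃ wα : PrehomG2.V k,
      wα.map (algebraMap k K) =
        PrehomG2.rep K (PrehomG2.gAlpha α (PrehomG2.ne_zero_of_not_mem_range hα))
          (PrehomG2.wPt K) ∧
      -- the identity component of its stabilizer is a functor `N` of subgroups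
      ∃ N : ∀ (R : Type v) [CommRing R] [Algebra k R], Subgroup (PrehomG2.Amb R),
        (∀ (R : Type v) [CommRing R] [Algebra k R],
          (N R : Set (PrehomG2.Amb R)) = PrehomG2.stabIdentityComponent wα R) ∧
        -- inside `GL(7, R(α)) × GL(2, R(α))` it is `{g_α d(A) g_α⁻¹ | A ∈ U_α(1,1)} · T̃`
        (∀ (R : Type v) [CommRing R] [Algebra k R],
          PrehomG2.toExt k K R '' (N R : Set (PrehomG2.Amb R)) =
            {h | ∃ A ∈ PrehomG2.U11 σ R, ∃ t ∈ PrehomG2.tildeT R,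
              h = PrehomG2.ofField k R
                    (PrehomG2.gAlpha α (PrehomG2.ne_zero_of_not_mem_range hα)) *
                  PrehomG2.d A *
                  (PrehomG2.ofField k R
                    (PrehomG2.gAlpha α (PrehomG2.ne_zero_of_not_mem_range hα)))⁻¹ *
                  PrehomG2.toExt k K R t}) ∧
        -- the product is direct: `(A, t) ↦ g_α d(A) g_α⁻¹ t` is an isomorphism of `k`-groups
        ∃ Φ : ∀ (R : Type v) [CommRing R] [Algebra k R],
            (PrehomG2.U11 σ R × PrehomG2.tildeT R) ≃* N R,
          (∀ (R : Type v) [CommRing R] [Algebra k R]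
              (A : PrehomG2.U11 σ R) (t : PrehomG2.tildeT R),
            PrehomG2.toExt k K R (Φ R (A, t)) =
              PrehomG2.ofField k R
                  (PrehomG2.gAlpha α (PrehomG2.ne_zero_of_not_mem_range hα)) *
                PrehomG2.d (A : GL (Fin 2) (TensorProduct k R K)) *
                (PrehomG2.ofField k R
                  (PrehomG2.gAlpha α (PrehomG2.ne_zero_of_not_mem_range hα)))⁻¹ *
                PrehomG2.toExt k K R t) ∧
          (∀ (R R' : Type v) [CommRing R] [Algebra k R] [CommRing R'] [Algebra k R']
              (f : R →ₐ[k] R') (A : PrehomG2.U11 σ R) (t : PrehomG2.tildeT R),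
            (Φ R' (PrehomG2.U11Map σ f A, PrehomG2.tildeTMap f.toRingHom t) : PrehomG2.Amb R') =
              PrehomG2.Amb.map f.toRingHom (Φ R (A, t))) := by
  obtain ⟨a, ha⟩ := hα2
  have hα0 := PrehomG2.ne_zero_of_not_mem_range hα
  refine ⟨PrehomG2.wAlpha a, PrehomG2.wAlpha_map α hα0 ha, fun R _ _ => PrehomG2.chiKer a R,
    fun R _ _ => ?_, fun R _ _ => ?_, fun R _ _ => PrehomG2.unitaryProdEquiv hα0 ha hK hσ R,
    fun R _ _ A t => PrehomG2.toExt_unitaryProdEquiv hα0 ha hK hσ (A, t),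
    fun R R' _ _ _ _ f A t => ?_⟩
  · ext g
    exact (PrehomG2.mem_stabIdentityComponent_iff hα0 ha g).symm
  · ext h
    constructor
    · rintro ⟨g, ⟨hg, hchi⟩, rfl⟩
      exact PrehomG2.exists_of_mem_stab hα0 ha hK hσ hg hchi
    · rintro ⟨A, hA, t, ht, rfl⟩
      obtain ⟨g, hg, hchi, h⟩ := PrehomG2.exists_mem_stab hα0 ha hK hσ hA ht
      exact ⟨g, ⟨hg, hchi⟩, h⟩
  -- Naturality is checked after the injection into R'(α)-points, where the map has an explicit
  -- formula and g_α comes from K.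
  · refine PrehomG2.toExt_injective (k := k) (K := K) ?_
    rw [PrehomG2.toExt_unitaryProdEquiv, PrehomG2.toExt_map, PrehomG2.toExt_unitaryProdEquiv,
      PrehomG2.unitaryProd_map]
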